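/- Let $n\ge 1$, let $\gamma$ be the standard Gaussian measure on $\mathbb R^n$ and $Y$ a random variable of law $\gamma$. For $t\ge 0$ let $$N_tf(x)=E\big[f(e^{-t}x+\sqrt{1-e^{-2t}}\,Y)\big]$$ be the Ornstein--Uhlenbeck semigroup, and for $a\in\mathbb R$ let $T_af(x)=f(e^{a/2}x)$. Functions $f:\mathbb R^n\to\mathbb R$ are measurable, and norms may be $+\infty$. (1) Let $t\ge 0$, $a\in\mathbb R$ and $1<q_1<q_2$ satisfy $q_2-1=e^{2t}(q_1e^{-a}-1)$. Then $$\|N_tf\|_{L^{q_2}(\gamma)}\le M^{n/2}\,\|T_{-a}f\|_{L^{q_1}(\gamma)},\qquad M=\Big(\frac{q_1-1}{e^{-2t}}\Big)^{1-\frac1{q_1}}\Big(\frac{q_2-1}{e^{-a}}\Big)^{\frac1{q_2}-1}\Big(\frac{1-e^{-2t}}{q_2-q_1}\Big)^{\frac1{q_2}-\frac1{q_1}}$$ (with $M=+\infty$ if $t=0$); if $T_{-a}f\in L^{q_1}(\gamma)$, then the expectation defining $N_tf(x)$ converges absolutely for every $x$, and $N_tf$ is measurable. (2) Let $t>0$ and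 $q_2=2$. As $q_1\downarrow 1$ under the constraint in (1), $-a\to\ln(e^{-2t}+1)$ and $M^{n/2}\to\big(\frac{e^{-2t}+1}{1-e^{-2t}}\big)^{n/4}$. Moreover $$\|N_tf\|_{L^2(\gamma)}\le\Big(\frac{e^{-2t}+1}{1-e^{-2t}}\Big)^{n/4}\|T_{\ln(e^{-2t}+1)}f\|_{L^1(\gamma)}=\int|f|\,V_t\,d\gamma,\qquad V_t(y)=(1-e^{-4t})^{-n/4}\exp\Big(\frac{|y|^2}{2}\,\frac1{1+e^{2t}}\Big),$$ and if the right-hand side is finite, the expectation defining $N_tf(x)$ converges absolutely for every $x$, and $N_tf$ is measurable. This bound is sharp: if $V:\mathbb R^n\to[0,\infty]$ is measurable and $\|N_tf\|_{L^2(\gamma)}\le\int|f|V\,d\gamma$ for all bounded measurable $f$, then $V\ge V_t$ $\gamma$-almost everywhere. (3) For every $t>0$ there is a unique continuous $n_t:\mathbb R^n\times\mathbb R^n\to\mathbb R$, with $n_t(x,\cdot)\in L^1(\gamma)$ for every $x$, such that $N_tf(x)=\int f(y)\,n_t(x,y)\,\gamma(dy)$ for all bounded measurable $f$ and all $x$.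 For all $t>0$ and all $x,y$, $$n_{2t}(x,y)\le V_t(x)V_t(y),\qquad n_{2t}(x,x)\le V_t(x)^2,$$ and the bound on the diagonal is sharp: $n_{2t}(x,x)=V_t(x)^2$. (4) For every $t>0$, $N_t$ is a bounded positive self-adjoint operator on $L^2(\gamma)$ of finite trace, with $$\operatorname{tr}N_t=\sum_i\langle e_i,N_te_i\rangle_{L^2(\gamma)}=\int n_t(x,x)\,d\gamma(x)=\int V_{t/2}^2\,d\gamma=(1-e^{-t})^{-n}$$ for every orthonormal (Hilbert) basis $(e_i)$ of $L^2(\gamma)$. -/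

import Mathlib

open MeasureTheory ProbabilityTheory Filter Set
open scoped ENNReal Topology

noncomputable section

/-- Dilations: `(T_a f)(x) = f (e^{a/2} x)`, for every real `a`. -/
def dilation {n : ℕ} (a : ℝ) (f : EuclideanSpace ℝ (Fin n) → ℝ) :
    EuclideanSpace ℝ (Fin n) → ℝ :=
  fun x => f (Real.exp (a / 2) • x)

/-- The point `e^{-t} x + (1 - e^{-2t})^{1/2} y` of the Mehler formula. -/
def mehlerPoint {n : ℕ} (t : ℝ) (x y : EuclideanSpace ℝ (Fin n)) :
    EuclideanSpace ℝ (Fin n) :=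
  Real.exp (-t) • x + Real.sqrt (1 - Real.exp (-2 * t)) • y

/-- The Ornstein-Uhlenbeck semigroup, by the Mehler formula:
`N_t f (x) = ∫ f (e^{-t} x + (1 - e^{-2t})^{1/2} y) dγ(y)`, with `γ` the standard Gaussian law. -/
def ouSemigroup {n : ℕ} (t : ℝ) (f : EuclideanSpace ℝ (Fin n) → ℝ) :
    EuclideanSpace ℝ (Fin n) → ℝ :=
  fun x => ∫ y, f (mehlerPoint t x y) ∂(stdGaussian (EuclideanSpace ℝ (Fin n)))

/-- The constant `M`, computed in `[0, ∞]`.  For `t > 0` and `1 < q₁ < q₂` it is a positive real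
number; at `t = 0` the last factor is a negative power of zero, hence `M = ∞`. -/
def nashConst (t a q₁ q₂ : ℝ) : ℝ≥0∞ :=
  ENNReal.ofReal ((q₁ - 1) / Real.exp (-2 * t)) ^ (1 - 1 / q₁) *
  ENNReal.ofReal ((q₂ - 1) / Real.exp (-a)) ^ (1 / q₂ - 1) *
  ENNReal.ofReal ((1 - Real.exp (-2 * t)) / (q₂ - q₁)) ^ (1 / q₂ - 1 / q₁)

/-- The weight `V_t(y) = (1 - e^{-4t})^{-n/4} exp ((|y|²/2) / (1 + e^{2t}))`. -/
def ouWeight {n : ℕ} (t : ℝ) (y : EuclideanSpace ℝ (Fin n)) : ℝ :=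
  (1 - Real.exp (-4 * t)) ^ (-(n : ℝ) / 4) *
    Real.exp (‖y‖ ^ 2 / 2 * (1 / (1 + Real.exp (2 * t))))

/-- `k` is the kernel (density) of `N_t` with respect to `γ`:
`N_t f (x) = ∫ f(y) k(x, y) dγ(y)` for all bounded measurable `f` and all `x`.
Continuity singles out the version whose diagonal values make sense. -/
structure IsOUKernel {n : ℕ} (t : ℝ)
    (k : EuclideanSpace ℝ (Fin n) → EuclideanSpace ℝ (Fin n) → ℝ) : Prop where
  continuous : Continuous (Function.uncurry k)
  integrable : ∀ x, Integrable (k x) (stdGaussian (EuclideanSpace ℝ (Fin n)))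
  repr : ∀ f : EuclideanSpace ℝ (Fin n) → ℝ, Measurable f → (∃ C : ℝ, ∀ x, |f x| ≤ C) →
    ∀ x, ouSemigroup t f x = ∫ y, f y * k x y ∂(stdGaussian (EuclideanSpace ℝ (Fin n)))

end

/-!
The dimensional Nash bound is, by duality, a bilinear inequality of Young type
`∫∫ f ^ α g ^ β K ≤ C (∫ f) ^ α (∫ g) ^ β` with `α + β > 1` for a Gaussian kernel `K`. On the line
it is proved by Barthe's argument: transport `f` and `g` monotonically onto suitable centred
Gaussians, change variables along a linear mixture of the two transports, and compare its Jacobian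
with the derivatives of the transports by weighted AM-GM; the constant is that of the Gaussian
case. Applying the inequality in one factor after the other tensorizes it, hence the constant
`M ^ (n / 2)`.

At the endpoint `q₁ = 1`, `q₂ = 2` no transport is needed. With `K_ρ` the Mehler kernel,
`∫ K_ρ(x, y) K_ρ(x, z) γ(dx) = K_{ρ²}(y, z) ≤ V_t(y) V_t(z)` for `ρ = e^{-t}`, with equality on the
diagonal: the inequality bounds `‖N_t f‖₂²`, and testing on `f` concentrated near a point shows that
the weight is optimal. Likewise `⟨e, N_t e⟩ = ‖N_{t/2} e‖₂²`, so Parseval's identity for the kernel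
of `N_{t/2}` turns the trace into the integral of `K_ρ` over the diagonal.
-/

section MonotoneTransport

variable {f g : ℝ → ℝ}

theorem integral_Iic_eq_add_intervalIntegral (hf : Integrable f) (a x : ℝ) :
    ∫ t in Iic x, f t = (∫ t in Iic a, f t) + ∫ t in a..x, f t := by
  rw [← intervalIntegral.integral_Iic_sub_Iic hf.integrableOn hf.integrableOn]
  ring

theorem ae_hasDerivAt_integral_Iic (hf : Integrable f) :
    ∀ᵐ x, HasDerivAt (fun x => ∫ t in Iic x, f t) (f x) x := by
  filter_upwards [LocallyIntegrable.ae_hasDerivAt_integral hf.locallyIntegrable] with x hx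
  simpa only [← integral_Iic_eq_add_intervalIntegral hf] using (hx 0).const_add (∫ t in Iic 0, f t)

theorem hasStrictDerivAt_integral_Iic (hg : Integrable g) (hcont : Continuous g) (x : ℝ) :
    HasStrictDerivAt (fun x => ∫ t in Iic x, g t) (g x) x := by
  simpa only [← integral_Iic_eq_add_intervalIntegral hg] using
    (hcont.integral_hasStrictDerivAt 0 x).const_add (∫ t in Iic 0, g t)

theorem exists_integral_Iic_eq (hg : Integrable g) (hcont : Continuous g) {c : ℝ}
    (hc : c ∈ Ioo 0 (∫ t, g t)) : ∃ x, ∫ t in Iic x, g t = c := by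
  have hbot : Tendsto (fun x => ∫ t in Iic x, g t) atBot (𝓝 0) :=
    tendsto_integral_Iic_zero tendsto_id
  have htop : Tendsto (fun x => ∫ t in Iic x, g t) atTop (𝓝 (∫ t, g t)) :=
    (aecover_Iic tendsto_id).integral_tendsto_of_countably_generated hg
  obtain ⟨x, hx⟩ := (hbot.eventually_lt_const hc.1).exists
  obtain ⟨y, hy⟩ := (htop.eventually_const_lt hc.2).exists
  exact mem_range_of_exists_le_of_exists_ge (continuous_iff_continuousAt.2 fun x =>
    (hasStrictDerivAt_integral_Iic hg hcont x).hasDerivAt.continuousAt) ⟨x, hx.le⟩ ⟨y, hy.le⟩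

theorem eq_of_monotone_of_hasDerivAt_ne_zero {F : ℝ → ℝ} (hF : Monotone F) {c x y : ℝ}
    (hx : HasDerivAt F c x) (hc : c ≠ 0) (hxy : F y = F x) : y = x := by
  by_contra hne
  have hconst : ∀ z ∈ uIcc y x, F z = F x := fun z hz => by
    simpa [hxy] using hF.mapsTo_uIcc hz
  exact hc ((uniqueDiffOn_Icc (inf_lt_sup.2 hne) x right_mem_uIcc).eq_deriv _
    hx.hasDerivWithinAt ((hasDerivWithinAt_const x _ _).congr hconst rfl))

theorem hasDerivAt_of_injective_of_comp_eventuallyEq {F G T : ℝ → ℝ} {f' g' x : ℝ}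
    (hG : Function.Injective G) (hG' : HasStrictDerivAt G g' (T x)) (hg' : g' ≠ 0)
    (hF : HasDerivAt F f' x) (hGT : G ∘ T =ᶠ[𝓝 x] F) : HasDerivAt T (f' / g') x := by
  have hx : G (T x) = F x := hGT.eq_of_nhds
  have hright : ∀ᶠ y in 𝓝 x, G (hG'.localInverse G g' (T x) hg' (F y)) = F y :=
    hF.continuousAt (hx ▸ hG'.eventually_right_inverse hg')
  have hcomp := (hx ▸ (hG'.to_localInverse hg').hasDerivAt : HasDerivAt _ g'⁻¹ (F x)).comp x hF
  rw [div_eq_inv_mul]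
  refine hcomp.congr_of_eventuallyEq ?_
  filter_upwards [hright, hGT] with y hy hTy
  exact hG (hTy.trans hy.symm)

theorem monotone_integral_Iic (hf : Integrable f) (hnonneg : 0 ≤ f) :
    Monotone fun x => ∫ t in Iic x, f t := fun _ _ h =>
  setIntegral_mono_set hf.integrableOn (ae_of_all _ hnonneg) (Iic_subset_Iic.2 h).eventuallyLE

theorem integral_Iic_mem_Ioo (hf : Integrable f) (hnonneg : 0 ≤ f) {c x : ℝ}
    (hx : HasDerivAt (fun x => ∫ t in Iic x, f t) c x) (hc : c ≠ 0) :
    ∫ t in Iic x, f t ∈ Ioo 0 (∫ t, f t) := by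
  have hF := monotone_integral_Iic hf hnonneg
  have hne {y : ℝ} := mt (eq_of_monotone_of_hasDerivAt_ne_zero hF hx hc (y := y))
  constructor
  · calc 0 ≤ ∫ t in Iic (x - 1), f t := setIntegral_nonneg measurableSet_Iic fun t _ => hnonneg t
      _ < ∫ t in Iic x, f t := (hF (sub_one_lt x).le).lt_of_ne (hne (sub_one_lt x).ne)
  · calc ∫ t in Iic x, f t < ∫ t in Iic (x + 1), f t :=
          (hF (lt_add_one x).le).lt_of_ne' (hne (lt_add_one x).ne')
      _ ≤ ∫ t, f t := setIntegral_le_integral hf (ae_of_all _ hnonneg)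

/-- The increasing rearrangement `T` of the mass `f dx` onto `g dx`: it is determined by
`∫_{-∞}^{T x} g = ∫_{-∞}^x f`, and is therefore only controlled on a set carrying `f dx`. -/
theorem exists_monotone_transport (hfm : Measurable f) (hf : Integrable f) (hnonneg : 0 ≤ f)
    (hg : Integrable g) (hcont : Continuous g) (hpos : ∀ x, 0 < g x)
    (hfg : ∫ x, f x = ∫ x, g x) :
    ∃ (T : ℝ → ℝ) (s : Set ℝ), MeasurableSet s ∧ StrictMonoOn T s ∧ (∀ᵐ x, x ∉ s → f x = 0) ∧
      ∀ x ∈ s, 0 < f x ∧ HasDerivAt T (f x / g (T x)) x := by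
  set F : ℝ → ℝ := fun x => ∫ t in Iic x, f t
  set G : ℝ → ℝ := fun x => ∫ t in Iic x, g t
  have hF : Monotone F := monotone_integral_Iic hf hnonneg
  have hG : StrictMono G := strictMono_of_hasDerivAt_pos
    (fun x => (hasStrictDerivAt_integral_Iic hg hcont x).hasDerivAt) hpos
  obtain ⟨u, hu, hum, hF'⟩ := (ae_hasDerivAt_integral_Iic hf).exists_measurable_mem
  set s : Set ℝ := u ∩ {x | 0 < f x}
  have hmem : ∀ x ∈ s, F x ∈ Ioo 0 (∫ t, g t) := fun x hx =>
    hfg ▸ integral_Iic_mem_Ioo hf hnonneg (hF' x hx.1) (ne_of_gt hx.2)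
  set T : ℝ → ℝ := fun x => Function.invFun G (F x)
  have hGT : ∀ x, F x ∈ Ioo 0 (∫ t, g t) → G (T x) = F x := fun x hx =>
    Function.invFun_eq (exists_integral_Iic_eq hg hcont hx)
  refine ⟨T, s, hum.inter (measurableSet_lt measurable_const hfm), ?_, ?_, ?_⟩
  · intro x hx y hy hxy
    rw [← hG.lt_iff_lt, hGT x (hmem x hx), hGT y (hmem y hy)]
    exact (hF hxy.le).lt_of_ne' fun h =>
      hxy.ne' (eq_of_monotone_of_hasDerivAt_ne_zero hF (hF' x hx.1) (ne_of_gt hx.2) h)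
  · filter_upwards [hu] with x hx hxs
    exact le_antisymm (not_lt.1 fun h => hxs ⟨hx, h⟩) (hnonneg x)
  · intro x hx
    have hFx : HasDerivAt F (f x) x := hF' x hx.1
    refine ⟨hx.2, hasDerivAt_of_injective_of_comp_eventuallyEq hG.injective
      (hasStrictDerivAt_integral_Iic hg hcont _) (hpos _).ne' hFx ?_⟩
    filter_upwards [hFx.continuousAt (isOpen_Ioo.mem_nhds (hmem x hx))] with y hy
    exact hGT y hy

end MonotoneTransport

section GaussianIntegrals

theorem lintegral_exp_neg_mul_sq {c : ℝ} (hc : 0 < c) :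
    ∫⁻ x : ℝ, ENNReal.ofReal (Real.exp (-c * x ^ 2)) = ENNReal.ofReal √(Real.pi / c) := by
  rw [← integral_gaussian, ofReal_integral_eq_lintegral_ofReal (integrable_exp_neg_mul_sq hc)
    (ae_of_all _ fun x => (Real.exp_pos _).le)]

theorem lintegral_exp_neg_quadratic {P Q R : ℝ} (hP : 0 < P) (hdet : 0 < P * R - Q ^ 2) :
    ∫⁻ p : ℝ × ℝ, ENNReal.ofReal
        (Real.exp (-(P * p.1 ^ 2 + 2 * Q * p.1 * p.2 + R * p.2 ^ 2) / 2)) =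
      ENNReal.ofReal (2 * Real.pi / √(P * R - Q ^ 2)) := by
  have hcomplete (x y : ℝ) :
      ENNReal.ofReal (Real.exp (-(P * x ^ 2 + 2 * Q * x * y + R * y ^ 2) / 2)) =
        ENNReal.ofReal (Real.exp (-((P * R - Q ^ 2) / (2 * P)) * y ^ 2)) *
          ENNReal.ofReal (Real.exp (-(P / 2) * (x + Q / P * y) ^ 2)) := by
    rw [← ENNReal.ofReal_mul (Real.exp_pos _).le, ← Real.exp_add]
    congr 2
    field_simp
    ring
  have hinner (y : ℝ) : ∫⁻ x : ℝ, ENNReal.ofReal (Real.exp (-(P / 2) * (x + Q / P * y) ^ 2)) =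
      ENNReal.ofReal √(Real.pi / (P / 2)) := by
    rw [lintegral_add_right_eq_self fun x : ℝ => ENNReal.ofReal (Real.exp (-(P / 2) * x ^ 2)),
      lintegral_exp_neg_mul_sq (by positivity)]
  rw [Measure.volume_eq_prod, lintegral_prod_symm _ (by fun_prop)]
  simp_rw [hcomplete, lintegral_const_mul' _ _ ENNReal.ofReal_ne_top, hinner]
  rw [lintegral_mul_const' _ _ ENNReal.ofReal_ne_top, lintegral_exp_neg_mul_sq (by positivity),
    ← ENNReal.ofReal_mul (by positivity), ← Real.sqrt_mul (by positivity),
    ← Real.sqrt_sq (by positivity : 0 ≤ 2 * Real.pi), ← Real.sqrt_div (by positivity)]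
  congr 2
  field_simp

end GaussianIntegrals

section GaussianYoung

variable {α β a b u v : ℝ} {T S : ℝ → ℝ}

theorem rpow_mul_rpow_le_bilinear (hα : α ≤ 1) (hβ : β ≤ 1) (hαβ : 1 ≤ α + β) {p q : ℝ}
    (hp : 0 < p) (hq : 0 < q) :
    p ^ α * q ^ β ≤ (α + β - 1) * (p * q) + (1 - β) * p + (1 - α) * q := by
  have := Real.geom_mean_le_arith_mean3_weighted (sub_nonneg.2 hαβ) (sub_nonneg.2 hβ)
    (sub_nonneg.2 hα) (mul_pos hp hq).le hp.le hq.le (by ring)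
  calc p ^ α * q ^ β
      = (p * q) ^ (α + β - 1) * p ^ (1 - β) * q ^ (1 - α) := by
        rw [Real.mul_rpow hp.le hq.le, mul_assoc, mul_mul_mul_comm, ← Real.rpow_add hp,
          ← Real.rpow_add hq]
        ring_nf
    _ ≤ _ := this

/-- The map `(aT(x) + u(ux - vy), bS(y) - v(ux - vy))`, the combination of the transports `T`, `S`
and of the identity along `ux - vy` that occurs in Barthe's proof of Brascamp-Lieb inequalities. -/
noncomputable def youngMap (a b u v : ℝ) (T S : ℝ → ℝ) (p : ℝ × ℝ) : ℝ × ℝ :=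
  (a * T p.1 + u * (u * p.1 - v * p.2), b * S p.2 - v * (u * p.1 - v * p.2))

/-- The derivative of `youngMap` at a point where `T`, `S` have derivatives `p`, `q`. -/
noncomputable def youngMapFDeriv (a b u v p q : ℝ) : ℝ × ℝ →L[ℝ] ℝ × ℝ :=
  (Matrix.toLin (.finTwoProd ℝ) (.finTwoProd ℝ)
    !![a * p + u ^ 2, -(u * v); -(u * v), b * q + v ^ 2]).toContinuousLinearMap

theorem det_youngMapFDeriv (p q : ℝ) :
    (youngMapFDeriv a b u v p q).det = a * b * (p * q) + a * v ^ 2 * p + b * u ^ 2 * q := by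
  rw [youngMapFDeriv, LinearMap.det_toContinuousLinearMap, LinearMap.det_toLin,
    Matrix.det_fin_two_of]
  ring

theorem hasFDerivAt_youngMap {p : ℝ × ℝ} {T' S' : ℝ} (hT : HasDerivAt T T' p.1)
    (hS : HasDerivAt S S' p.2) :
    HasFDerivAt (youngMap a b u v T S) (youngMapFDeriv a b u v T' S') p := by
  have hlin : HasFDerivAt (fun p : ℝ × ℝ => u * p.1 - v * p.2)
      (u • ContinuousLinearMap.fst ℝ ℝ ℝ - v • ContinuousLinearMap.snd ℝ ℝ ℝ) p :=
    (hasFDerivAt_fst.const_mul u).sub (hasFDerivAt_snd.const_mul v)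
  have h := (((hT.comp_hasFDerivAt p hasFDerivAt_fst).const_mul a).add (hlin.const_mul u)).prodMk
    (((hS.comp_hasFDerivAt p hasFDerivAt_snd).const_mul b).sub (hlin.const_mul v))
  rw [youngMapFDeriv, Matrix.toLin_finTwoProd_toContinuousLinearMap]
  convert! h using 1
  ext <;> simp <;> ring

theorem sub_mul_sub_pos_of_strictMonoOn {s : Set ℝ} (hT : StrictMonoOn T s) {x y : ℝ} (hx : x ∈ s)
    (hy : y ∈ s) (hxy : x ≠ y) : 0 < (T x - T y) * (x - y) := by
  rcases hxy.lt_or_gt with h | h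
  · exact mul_pos_of_neg_of_neg (sub_neg.2 (hT hx hy h)) (sub_neg.2 h)
  · exact mul_pos (sub_pos.2 (hT hy hx h)) (sub_pos.2 h)

theorem injOn_youngMap (ha : 0 < a) (hb : 0 < b) {s r : Set ℝ} (hT : StrictMonoOn T s)
    (hS : StrictMonoOn S r) : InjOn (youngMap a b u v T S) (s ×ˢ r) := by
  rintro ⟨x, y⟩ ⟨hx, hy⟩ ⟨x', y'⟩ ⟨hx', hy'⟩ h
  simp only [youngMap, Prod.mk.injEq] at h
  have hsum : a * ((T x - T x') * (x - x')) + b * ((S y - S y') * (y - y')) +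
      (u * (x - x') - v * (y - y')) ^ 2 = 0 := by
    linear_combination (x - x') * h.1 + (y - y') * h.2
  have hTx : x ≠ x' → 0 < (T x - T x') * (x - x') := sub_mul_sub_pos_of_strictMonoOn hT hx hx'
  have hSy : y ≠ y' → 0 < (S y - S y') * (y - y') := sub_mul_sub_pos_of_strictMonoOn hS hy hy'
  rcases eq_or_ne x x' with rfl | hxx <;> rcases eq_or_ne y y' with rfl | hyy
  · rfl
  · nlinarith [mul_pos hb (hSy hyy)]
  · nlinarith [mul_pos ha (hTx hxx)]
  · nlinarith [mul_pos ha (hTx hxx), mul_pos hb (hSy hyy)]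

theorem quadratic_youngMap_le (ha : 0 < a) (hb : 0 < b) (x y : ℝ) :
    (b + v ^ 2) / (a * b + a * v ^ 2 + b * u ^ 2) * (youngMap a b u v T S (x, y)).1 ^ 2 +
        2 * (u * v / (a * b + a * v ^ 2 + b * u ^ 2)) * (youngMap a b u v T S (x, y)).1 *
          (youngMap a b u v T S (x, y)).2 +
        (a + u ^ 2) / (a * b + a * v ^ 2 + b * u ^ 2) * (youngMap a b u v T S (x, y)).2 ^ 2 ≤
      a * T x ^ 2 + b * S y ^ 2 + (u * x - v * y) ^ 2 := by
  simp only [youngMap]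
  generalize u * x - v * y = c
  have hD : 0 < a * b + a * v ^ 2 + b * u ^ 2 := by positivity
  calc _ = ((b + v ^ 2) * (a * T x + u * c) ^ 2 + 2 * (u * v) * (a * T x + u * c) *
          (b * S y - v * c) + (a + u ^ 2) * (b * S y - v * c) ^ 2) /
          (a * b + a * v ^ 2 + b * u ^ 2) := by ring
    _ ≤ _ := by
      rw [div_le_iff₀' hD]
      nlinarith [mul_nonneg (mul_pos ha hb).le (sq_nonneg (u * T x - v * S y - c))]

theorem youngDet_mul_rpow_le_det (hα : α < 1) (hβ : β < 1) (hαβ : 1 < α + β)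
    (hau : a * (1 - α) = (α + β - 1) * u ^ 2) (hbv : b * (1 - β) = (α + β - 1) * v ^ 2)
    (hD : 0 < a * b + a * v ^ 2 + b * u ^ 2) {p q : ℝ} (hp : 0 < p) (hq : 0 < q) :
    (a * b + a * v ^ 2 + b * u ^ 2) * (p ^ α * q ^ β) ≤ (youngMapFDeriv a b u v p q).det := by
  set D := a * b + a * v ^ 2 + b * u ^ 2
  have hθ : α + β - 1 ≠ 0 := by linarith
  have hDθ : D * (α + β - 1) = a * b := by linear_combination -b * hau - a * hbv
  have hDβ : D * (1 - β) = a * v ^ 2 := mul_left_cancel₀ hθ (by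
    linear_combination (1 - β) * hDθ + a * hbv)
  have hDα : D * (1 - α) = b * u ^ 2 := mul_left_cancel₀ hθ (by
    linear_combination (1 - α) * hDθ + b * hau)
  rw [det_youngMapFDeriv, ← hDθ, ← hDβ, ← hDα]
  linarith [mul_le_mul_of_nonneg_left
    (rpow_mul_rpow_le_bilinear hα.le hβ.le hαβ.le hp hq) hD.le]

theorem rpow_mul_exp_le_abs_det_mul_exp (hα : α < 1) (hβ : β < 1) (hαβ : 1 < α + β) (ha : 0 < a)
    (hb : 0 < b) (hau : a * (1 - α) = (α + β - 1) * u ^ 2)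
    (hbv : b * (1 - β) = (α + β - 1) * v ^ 2) (x y : ℝ) {p q : ℝ} (hp : 0 < p) (hq : 0 < q) :
    p ^ α * q ^ β * Real.exp (-(a * T x ^ 2 + b * S y ^ 2 + (u * x - v * y) ^ 2) / 2) ≤
      (a * b + a * v ^ 2 + b * u ^ 2)⁻¹ * (|(youngMapFDeriv a b u v p q).det| * Real.exp
        (-((b + v ^ 2) / (a * b + a * v ^ 2 + b * u ^ 2) * (youngMap a b u v T S (x, y)).1 ^ 2 +
          2 * (u * v / (a * b + a * v ^ 2 + b * u ^ 2)) * (youngMap a b u v T S (x, y)).1 *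
            (youngMap a b u v T S (x, y)).2 +
          (a + u ^ 2) / (a * b + a * v ^ 2 + b * u ^ 2) *
            (youngMap a b u v T S (x, y)).2 ^ 2) / 2)) := by
  have hD : 0 < a * b + a * v ^ 2 + b * u ^ 2 := by positivity
  have hjac := youngDet_mul_rpow_le_det hα hβ hαβ hau hbv hD hp hq
  rw [← mul_assoc, inv_mul_eq_div]
  refine mul_le_mul ((le_div_iff₀' hD).2 (hjac.trans (le_abs_self _))) (Real.exp_le_exp.2 ?_)
    (Real.exp_pos _).le (by positivity)
  exact div_le_div_of_nonneg_right (neg_le_neg (quadratic_youngMap_le ha hb x y)) two_pos.le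

theorem setLIntegral_youngMap_le (hα : α < 1) (hβ : β < 1) (hαβ : 1 < α + β) (ha : 0 < a)
    (hb : 0 < b) (hau : a * (1 - α) = (α + β - 1) * u ^ 2)
    (hbv : b * (1 - β) = (α + β - 1) * v ^ 2) {T' S' : ℝ → ℝ} {s r : Set ℝ}
    (hs : MeasurableSet s) (hr : MeasurableSet r) (hT : StrictMonoOn T s) (hS : StrictMonoOn S r)
    (hT' : ∀ x ∈ s, 0 < T' x ∧ HasDerivAt T (T' x) x)
    (hS' : ∀ y ∈ r, 0 < S' y ∧ HasDerivAt S (S' y) y) :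
    ∫⁻ p in s ×ˢ r, ENNReal.ofReal (T' p.1 ^ α * S' p.2 ^ β *
        Real.exp (-(a * T p.1 ^ 2 + b * S p.2 ^ 2 + (u * p.1 - v * p.2) ^ 2) / 2)) ≤
      ENNReal.ofReal (2 * Real.pi / √(a * b + a * v ^ 2 + b * u ^ 2)) := by
  set D := a * b + a * v ^ 2 + b * u ^ 2
  have hD : 0 < D := by positivity
  set G : ℝ × ℝ → ℝ≥0∞ := fun p => ENNReal.ofReal (Real.exp
    (-((b + v ^ 2) / D * p.1 ^ 2 + 2 * (u * v / D) * p.1 * p.2 + (a + u ^ 2) / D * p.2 ^ 2) / 2))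
  have hdet : (b + v ^ 2) / D * ((a + u ^ 2) / D) - (u * v / D) ^ 2 = 1 / D := by
    field_simp
    ring
  have hpoint : ∀ p ∈ s ×ˢ r, ENNReal.ofReal (T' p.1 ^ α * S' p.2 ^ β *
      Real.exp (-(a * T p.1 ^ 2 + b * S p.2 ^ 2 + (u * p.1 - v * p.2) ^ 2) / 2)) ≤
      ENNReal.ofReal D⁻¹ * (ENNReal.ofReal |(youngMapFDeriv a b u v (T' p.1) (S' p.2)).det| *
        G (youngMap a b u v T S p)) := by
    rintro ⟨x, y⟩ ⟨hx, hy⟩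
    rw [← ENNReal.ofReal_mul (abs_nonneg _), ← ENNReal.ofReal_mul (inv_pos.2 hD).le]
    exact ENNReal.ofReal_le_ofReal (rpow_mul_exp_le_abs_det_mul_exp hα hβ hαβ ha hb hau hbv x y
      (hT' x hx).1 (hS' y hy).1)
  calc _ ≤ ∫⁻ p in s ×ˢ r, ENNReal.ofReal D⁻¹ *
        (ENNReal.ofReal |(youngMapFDeriv a b u v (T' p.1) (S' p.2)).det| *
          G (youngMap a b u v T S p)) := setLIntegral_mono' (hs.prod hr) hpoint
    _ = ENNReal.ofReal D⁻¹ * ∫⁻ p in youngMap a b u v T S '' s ×ˢ r, G p := by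
        rw [lintegral_const_mul' _ _ ENNReal.ofReal_ne_top,
          lintegral_image_eq_lintegral_abs_det_fderiv_mul volume (hs.prod hr) (fun p hp =>
            (hasFDerivAt_youngMap (hT' p.1 hp.1).2 (hS' p.2 hp.2).2).hasFDerivWithinAt)
            (injOn_youngMap ha hb hT hS)]
    _ ≤ ENNReal.ofReal D⁻¹ * ENNReal.ofReal (2 * Real.pi / √(1 / D)) := by
        gcongr
        rw [← hdet, ← lintegral_exp_neg_quadratic (by positivity) (hdet ▸ by positivity)]
        exact setLIntegral_le_lintegral _ _
    _ = _ := by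
        rw [← ENNReal.ofReal_mul (inv_pos.2 hD).le, Real.sqrt_div zero_le_one, Real.sqrt_one,
          div_div_eq_mul_div, div_one, inv_mul_eq_div, mul_div_assoc, Real.sqrt_div_self,
          div_eq_mul_inv]

/-- The centred Gaussian density on `ℝ` of precision (inverse variance) `c`. -/
noncomputable def precisionDensity (c x : ℝ) : ℝ :=
  (c / (2 * Real.pi)) ^ (1 / 2 : ℝ) * Real.exp (-(c / 2) * x ^ 2)

theorem precisionDensity_pos {c : ℝ} (hc : 0 < c) (x : ℝ) : 0 < precisionDensity c x := by
  unfold precisionDensity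
  positivity

theorem continuous_precisionDensity (c : ℝ) : Continuous (precisionDensity c) := by
  unfold precisionDensity
  fun_prop

theorem integrable_precisionDensity {c : ℝ} (hc : 0 < c) : Integrable (precisionDensity c) :=
  (integrable_exp_neg_mul_sq (half_pos hc)).const_mul _

theorem integral_precisionDensity {c : ℝ} (hc : 0 < c) : ∫ x, precisionDensity c x = 1 := by
  simp only [precisionDensity]
  rw [integral_const_mul, integral_gaussian, ← Real.sqrt_eq_rpow, ← Real.sqrt_mul (by positivity),
    Real.sqrt_eq_one]
  field_simp

theorem mul_precisionDensity_rpow {c t : ℝ} (hc : 0 < c) (ht : 0 ≤ t) (α x : ℝ) :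
    (t * precisionDensity c x) ^ α =
      t ^ α * ((c / (2 * Real.pi)) ^ (α / 2) * Real.exp (-(α * c * x ^ 2) / 2)) := by
  rw [precisionDensity, Real.mul_rpow ht (by positivity), Real.mul_rpow (by positivity)
    (Real.exp_pos _).le, ← Real.rpow_mul (by positivity), ← Real.exp_mul]
  ring_nf

theorem exists_transport_to_gaussian {f : ℝ → ℝ} (hfm : Measurable f) (hf : Integrable f)
    (hnonneg : 0 ≤ f) (hf1 : ∫ x, f x = 1) {c : ℝ} (hc : 0 < c) :
    ∃ (T T' : ℝ → ℝ) (s : Set ℝ), MeasurableSet s ∧ StrictMonoOn T s ∧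
      (∀ᵐ x, x ∉ s → f x = 0) ∧ (∀ x ∈ s, 0 < T' x ∧ HasDerivAt T (T' x) x) ∧
      ∀ x ∈ s, f x = T' x * precisionDensity c (T x) := by
  have hpos := precisionDensity_pos hc
  obtain ⟨T, s, hs, hT, hfs, hT'⟩ := exists_monotone_transport hfm hf hnonneg
    (integrable_precisionDensity hc) (continuous_precisionDensity c) hpos
    (hf1.trans (integral_precisionDensity hc).symm)
  exact ⟨T, fun x => f x / precisionDensity c (T x), s, hs, hT, hfs,
    fun x hx => ⟨div_pos (hT' x hx).1 (hpos _), (hT' x hx).2⟩,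
    fun x _ => (div_mul_cancel₀ _ (hpos (T x)).ne').symm⟩

theorem mul_precisionDensity_rpow_mul_exp {s τ p q : ℝ} (hs : 0 < s) (hτ : 0 < τ) (hp : 0 ≤ p)
    (hq : 0 ≤ q) (x y c : ℝ) :
    (p * precisionDensity s x) ^ α * (q * precisionDensity τ y) ^ β * Real.exp (-c / 2) =
      (s / (2 * Real.pi)) ^ (α / 2) * (τ / (2 * Real.pi)) ^ (β / 2) *
        (p ^ α * q ^ β * Real.exp (-(α * s * x ^ 2 + β * τ * y ^ 2 + c) / 2)) := by
  have hexp : -(α * s * x ^ 2 + β * τ * y ^ 2 + c) / 2 =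
      -(α * s * x ^ 2) / 2 + -(β * τ * y ^ 2) / 2 + -c / 2 := by ring
  rw [mul_precisionDensity_rpow hs hp, mul_precisionDensity_rpow hτ hq, hexp, Real.exp_add,
    Real.exp_add]
  ring

theorem setLIntegral_eq_lintegral_of_ae_compl_eq_zero {X : Type*} [MeasurableSpace X]
    {μ : Measure X} {s : Set X} (hs : MeasurableSet s) {f : X → ℝ≥0∞}
    (h : ∀ᵐ x ∂μ, x ∉ s → f x = 0) : ∫⁻ x in s, f x ∂μ = ∫⁻ x, f x ∂μ := by
  rw [← lintegral_indicator hs]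
  exact lintegral_congr_ae (h.mono fun x hx => indicator_apply_eq_self.2 hx)

/-- The constant of the Gaussian Young inequality, attained by the
Gaussian densities of precisions `s` and `τ`. -/
noncomputable def gaussianYoungConst (α β s τ : ℝ) : ℝ :=
  (s / (2 * Real.pi)) ^ (α / 2) * (τ / (2 * Real.pi)) ^ (β / 2) *
    (2 * Real.pi / √(α * s * (β * τ) / (α + β - 1)))

theorem lintegral_gaussianYoung_le_of_integral_eq_one {s τ : ℝ} (hα : α ∈ Ioo 0 1)
    (hβ : β ∈ Ioo 0 1) (hαβ : 1 < α + β) (hs : 0 < s) (hτ : 0 < τ)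
    (hsu : α * s * (1 - α) = (α + β - 1) * u ^ 2) (hτv : β * τ * (1 - β) = (α + β - 1) * v ^ 2)
    {f g : ℝ → ℝ} (hfm : Measurable f) (hf : Integrable f) (hf0 : 0 ≤ f) (hf1 : ∫ x, f x = 1)
    (hgm : Measurable g) (hg : Integrable g) (hg0 : 0 ≤ g) (hg1 : ∫ x, g x = 1) :
    ∫⁻ p : ℝ × ℝ, ENNReal.ofReal (f p.1 ^ α * g p.2 ^ β * Real.exp (-(u * p.1 - v * p.2) ^ 2 / 2)) ≤
      ENNReal.ofReal (gaussianYoungConst α β s τ) := by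
  obtain ⟨T, T', A, hA, hT, hfA, hT', hfT⟩ := exists_transport_to_gaussian hfm hf hf0 hf1 hs
  obtain ⟨S, S', B, hB, hS, hgB, hS', hgS⟩ := exists_transport_to_gaussian hgm hg hg0 hg1 hτ
  have hD : α * s * (β * τ) + α * s * v ^ 2 + β * τ * u ^ 2 =
      α * s * (β * τ) / (α + β - 1) := by
    rw [eq_div_iff (by linarith)]
    linear_combination -(β * τ) * hsu - α * s * hτv
  have hsupp : ∀ᵐ p : ℝ × ℝ, p ∉ A ×ˢ B →
      ENNReal.ofReal (f p.1 ^ α * g p.2 ^ β * Real.exp (-(u * p.1 - v * p.2) ^ 2 / 2)) = 0 := by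
    filter_upwards [Measure.quasiMeasurePreserving_fst.ae hfA,
      Measure.quasiMeasurePreserving_snd.ae hgB] with p hpA hpB hp
    rcases not_and_or.1 hp with hp | hp
    · simp only [hpA hp, Real.zero_rpow hα.1.ne', zero_mul, ENNReal.ofReal_zero]
    · simp only [hpB hp, Real.zero_rpow hβ.1.ne', mul_zero, zero_mul, ENNReal.ofReal_zero]
  calc _ = ∫⁻ p in A ×ˢ B,
        ENNReal.ofReal (f p.1 ^ α * g p.2 ^ β * Real.exp (-(u * p.1 - v * p.2) ^ 2 / 2)) :=
        (setLIntegral_eq_lintegral_of_ae_compl_eq_zero (hA.prod hB) hsupp).symm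
    _ = ENNReal.ofReal ((s / (2 * Real.pi)) ^ (α / 2) * (τ / (2 * Real.pi)) ^ (β / 2)) *
        ∫⁻ p in A ×ˢ B, ENNReal.ofReal (T' p.1 ^ α * S' p.2 ^ β * Real.exp (-(α * s * T p.1 ^ 2 +
          β * τ * S p.2 ^ 2 + (u * p.1 - v * p.2) ^ 2) / 2)) := by
        rw [← lintegral_const_mul' _ _ ENNReal.ofReal_ne_top]
        refine setLIntegral_congr_fun (hA.prod hB) fun p hp => ?_
        rw [← ENNReal.ofReal_mul (by positivity), ← mul_precisionDensity_rpow_mul_exp hs hτ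
          (hT' _ hp.1).1.le (hS' _ hp.2).1.le, ← hfT _ hp.1, ← hgS _ hp.2]
    _ ≤ _ := by
        rw [gaussianYoungConst, ENNReal.ofReal_mul (q := _ / _) (by positivity), ← hD]
        exact mul_le_mul_right (setLIntegral_youngMap_le hα.2 hβ.2 hαβ (mul_pos hα.1 hs)
          (mul_pos hβ.1 hτ) hsu hτv hA hB hT hS hT' hS') _

end GaussianYoung

section YoungBound

variable {X Y X' Y' : Type*} [MeasurableSpace X] [MeasurableSpace Y] [MeasurableSpace X']
  [MeasurableSpace Y'] {μ : Measure X} {ν : Measure Y} {μ' : Measure X'} {ν' : Measure Y'}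
  {K : X → Y → ℝ≥0∞} {K' : X' → Y' → ℝ≥0∞} {α β : ℝ} {C C' : ℝ≥0∞}

/-- The kernel `K` satisfies the bilinear inequality
`∬ f^α g^β K ≤ C (∫ f)^α (∫ g)^β` for all nonnegative measurable `f` and `g`. -/
def YoungBound (μ : Measure X) (ν : Measure Y) (K : X → Y → ℝ≥0∞) (α β : ℝ) (C : ℝ≥0∞) : Prop :=
  ∀ ⦃f : X → ℝ≥0∞⦄ ⦃g : Y → ℝ≥0∞⦄, Measurable f → Measurable g →
    ∫⁻ x, ∫⁻ y, f x ^ α * g y ^ β * K x y ∂ν ∂μ ≤ C * (∫⁻ x, f x ∂μ) ^ α * (∫⁻ y, g y ∂ν) ^ β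

theorem rpow_mul_rpow_mul_eq_const_mul {I J : ℝ≥0∞} (hα : 0 ≤ α) (hβ : 0 ≤ β) (hI : I ≠ 0)
    (hI' : I ≠ ∞) (hJ : J ≠ 0) (hJ' : J ≠ ∞) (x y k : ℝ≥0∞) :
    x ^ α * y ^ β * k = I ^ α * J ^ β * ((I⁻¹ * x) ^ α * (J⁻¹ * y) ^ β * k) := by
  have hx : x = I * (I⁻¹ * x) := by rw [← mul_assoc, ENNReal.mul_inv_cancel hI hI', one_mul]
  have hy : y = J * (J⁻¹ * y) := by rw [← mul_assoc, ENNReal.mul_inv_cancel hJ hJ', one_mul]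
  conv_lhs =>
    rw [hx, hy, ENNReal.mul_rpow_of_nonneg _ _ hα, ENNReal.mul_rpow_of_nonneg _ _ hβ]
  ring

theorem YoungBound.of_lintegral_eq_one (hα : 0 < α) (hβ : 0 < β) (hC : C ≠ 0)
    (h : ∀ (f : X → ℝ≥0∞) (g : Y → ℝ≥0∞), Measurable f → Measurable g → ∫⁻ x, f x ∂μ = 1 →
      ∫⁻ y, g y ∂ν = 1 → ∫⁻ x, ∫⁻ y, f x ^ α * g y ^ β * K x y ∂ν ∂μ ≤ C) :
    YoungBound μ ν K α β C := by
  intro f g hf hg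
  set I := ∫⁻ x, f x ∂μ
  set J := ∫⁻ y, g y ∂ν
  rcases eq_or_ne I 0 with hI0 | hI0
  · suffices ∫⁻ x, ∫⁻ y, f x ^ α * g y ^ β * K x y ∂ν ∂μ = 0 by simp only [this, zero_le]
    refine lintegral_eq_zero_of_ae_eq_zero ?_
    filter_upwards [(lintegral_eq_zero_iff hf).1 hI0] with x hx
    simp only [hx, Pi.zero_apply, ENNReal.zero_rpow_of_pos hα, zero_mul, lintegral_zero]
  rcases eq_or_ne J 0 with hJ0 | hJ0
  · suffices ∫⁻ x, ∫⁻ y, f x ^ α * g y ^ β * K x y ∂ν ∂μ = 0 by simp only [this, zero_le]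
    refine lintegral_eq_zero_of_ae_eq_zero (ae_of_all _ fun x => lintegral_eq_zero_of_ae_eq_zero ?_)
    filter_upwards [(lintegral_eq_zero_iff hg).1 hJ0] with y hy
    simp only [hy, Pi.zero_apply, ENNReal.zero_rpow_of_pos hβ, mul_zero, zero_mul]
  have hIα : I ^ α ≠ 0 := fun h => hI0 ((ENNReal.rpow_eq_zero_iff_of_pos hα).1 h)
  have hJβ : J ^ β ≠ 0 := fun h => hJ0 ((ENNReal.rpow_eq_zero_iff_of_pos hβ).1 h)
  rcases eq_or_ne I ∞ with hI' | hI'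
  · rw [hI', ENNReal.top_rpow_of_pos hα, ENNReal.mul_top hC, ENNReal.top_mul hJβ]
    exact le_top
  rcases eq_or_ne J ∞ with hJ' | hJ'
  · rw [hJ', ENNReal.top_rpow_of_pos hβ, ENNReal.mul_top (mul_ne_zero hC hIα)]
    exact le_top
  have hnormalized := h (fun x => I⁻¹ * f x) (fun y => J⁻¹ * g y) (hf.const_mul _) (hg.const_mul _)
    (by rw [lintegral_const_mul _ hf, ENNReal.inv_mul_cancel hI0 hI'])
    (by rw [lintegral_const_mul _ hg, ENNReal.inv_mul_cancel hJ0 hJ'])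
  have hfin : I ^ α * J ^ β ≠ ∞ := ENNReal.mul_ne_top (ENNReal.rpow_ne_top_of_nonneg hα.le hI')
    (ENNReal.rpow_ne_top_of_nonneg hβ.le hJ')
  simp_rw [fun x y => rpow_mul_rpow_mul_eq_const_mul hα.le hβ.le hI0 hI' hJ0 hJ' (f x) (g y)
    (K x y), lintegral_const_mul' _ _ hfin]
  calc _ ≤ I ^ α * J ^ β * C := mul_le_mul_right hnormalized _
    _ = _ := by ring

theorem YoungBound.comp_measurePreserving {eX : X' ≃ᵐ X} {eY : Y' ≃ᵐ Y} (h : YoungBound μ ν K α β C)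
    (heX : MeasurePreserving eX μ' μ) (heY : MeasurePreserving eY ν' ν) :
    YoungBound μ' ν' (fun x y => K (eX x) (eY y)) α β C := by
  intro f g hf hg
  have := h (hf.comp eX.symm.measurable) (hg.comp eY.symm.measurable)
  simpa only [← heX.lintegral_comp_emb eX.measurableEmbedding,
    ← heY.lintegral_comp_emb eY.measurableEmbedding, Function.comp_apply,
    MeasurableEquiv.symm_apply_apply] using this

theorem YoungBound.const_mul [SFinite ν] (hK : Measurable (Function.uncurry K))
    (h : YoungBound μ ν K α β C) (c : ℝ≥0∞) :
    YoungBound μ ν (fun x y => c * K x y) α β (c * C) := by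
  intro f g hf hg
  calc _ = c * ∫⁻ x, ∫⁻ y, f x ^ α * g y ^ β * K x y ∂ν ∂μ := by
        rw [← lintegral_const_mul _ (by fun_prop)]
        refine lintegral_congr fun x => ?_
        rw [← lintegral_const_mul _ (by fun_prop)]
        exact lintegral_congr fun y => mul_left_comm _ _ _
    _ ≤ c * (C * (∫⁻ x, f x ∂μ) ^ α * (∫⁻ y, g y ∂ν) ^ β) := mul_le_mul_right (h hf hg) c
    _ = _ := by ring

theorem YoungBound.prod [SFinite μ] [SFinite ν] [SFinite μ'] [SFinite ν']
    (hK : Measurable (Function.uncurry K)) (hK' : Measurable (Function.uncurry K'))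
    (h : YoungBound μ ν K α β C) (h' : YoungBound μ' ν' K' α β C') :
    YoungBound (μ.prod μ') (ν.prod ν') (fun x y => K x.1 y.1 * K' x.2 y.2) α β (C * C') := by
  intro f g hf hg
  set F : X → ℝ≥0∞ := fun x => ∫⁻ x', f (x, x') ∂μ'
  set G : Y → ℝ≥0∞ := fun y => ∫⁻ y', g (y, y') ∂ν'
  have hF : Measurable F := hf.lintegral_prod_right'
  have hG : Measurable G := hg.lintegral_prod_right'
  have hH : Measurable fun p : (X × X') × Y × Y' =>
      f p.1 ^ α * g p.2 ^ β * (K p.1.1 p.2.1 * K' p.1.2 p.2.2) := by fun_prop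
  calc ∫⁻ x, ∫⁻ y, f x ^ α * g y ^ β * (K x.1 y.1 * K' x.2 y.2) ∂ν.prod ν' ∂μ.prod μ'
      = ∫⁻ x, ∫⁻ x', ∫⁻ y, ∫⁻ y', f (x, x') ^ α * g (y, y') ^ β * (K x y * K' x' y')
          ∂ν' ∂ν ∂μ' ∂μ := by
        rw [lintegral_prod _ hH.lintegral_prod_right'.aemeasurable]
        refine lintegral_congr fun x => lintegral_congr fun x' => ?_
        exact lintegral_prod _ (hH.comp measurable_prodMk_left).aemeasurable
    _ = ∫⁻ x, ∫⁻ y, ∫⁻ x', ∫⁻ y', f (x, x') ^ α * g (y, y') ^ β * (K x y * K' x' y')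
          ∂ν' ∂μ' ∂ν ∂μ :=
        lintegral_congr fun x => lintegral_lintegral_swap (by fun_prop)
    _ ≤ ∫⁻ x, ∫⁻ y, K x y * C' * F x ^ α * G y ^ β ∂ν ∂μ :=
        lintegral_mono fun x => lintegral_mono fun y =>
          h'.const_mul hK' (K x y) (hf.comp measurable_prodMk_left) (hg.comp measurable_prodMk_left)
    _ = ∫⁻ x, ∫⁻ y, F x ^ α * G y ^ β * (C' * K x y) ∂ν ∂μ := by
        refine lintegral_congr fun x => lintegral_congr fun y => ?_
        ring
    _ ≤ C' * C * (∫⁻ x, F x ∂μ) ^ α * (∫⁻ y, G y ∂ν) ^ β := h.const_mul hK C' hF hG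
    _ = C * C' * (∫⁻ x, f x ∂μ.prod μ') ^ α * (∫⁻ y, g y ∂ν.prod ν') ^ β := by
        rw [lintegral_prod _ hf.aemeasurable, lintegral_prod _ hg.aemeasurable, mul_comm C]

theorem YoungBound.pi [SigmaFinite μ] [SigmaFinite ν] (hK : Measurable (Function.uncurry K))
    (h : YoungBound μ ν K α β C) (n : ℕ) :
    YoungBound (Measure.pi fun _ : Fin n => μ) (Measure.pi fun _ : Fin n => ν)
      (fun x y => ∏ i, K (x i) (y i)) α β (C ^ n) := by
  induction n with
  | zero =>
    intro f g _ _
    simp [lintegral_unique]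
  | succ n ih =>
    have hpi : Measurable (Function.uncurry fun (x : Fin n → X) (y : Fin n → Y) =>
        ∏ i, K (x i) (y i)) := by
      fun_prop
    simp only [Fin.prod_univ_succ, pow_succ']
    exact (h.prod hK hpi ih).comp_measurePreserving
      (measurePreserving_piFinSuccAbove (fun _ => μ) 0)
      (measurePreserving_piFinSuccAbove (fun _ => ν) 0)

end YoungBound

section GaussianYoungInequality

variable {α β s τ u v : ℝ}

theorem gaussianYoungConst_pos (hα : 0 < α) (hβ : 0 < β) (hαβ : 1 < α + β) (hs : 0 < s)
    (hτ : 0 < τ) : 0 < gaussianYoungConst α β s τ := by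
  have : 0 < α + β - 1 := by linarith
  unfold gaussianYoungConst
  positivity

theorem integral_toReal_eq_one {X : Type*} [MeasurableSpace X] {μ : Measure X} {f : X → ℝ≥0∞}
    (hf : Measurable f) (hf1 : ∫⁻ x, f x ∂μ = 1) :
    Integrable (fun x => (f x).toReal) μ ∧ ∫ x, (f x).toReal ∂μ = 1 ∧
      ∀ᵐ x ∂μ, ENNReal.ofReal (f x).toReal = f x := by
  have hfin : ∫⁻ x, f x ∂μ ≠ ∞ := hf1 ▸ ENNReal.one_ne_top
  have hlt := ae_lt_top hf hfin
  refine ⟨integrable_toReal_of_lintegral_ne_top hf.aemeasurable hfin, ?_,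
    hlt.mono fun x hx => ENNReal.ofReal_toReal hx.ne⟩
  rw [integral_toReal hf.aemeasurable hlt, hf1, ENNReal.toReal_one]

theorem youngBound_gaussian_real (hα : α ∈ Ioo 0 1) (hβ : β ∈ Ioo 0 1) (hαβ : 1 < α + β)
    (hs : 0 < s) (hτ : 0 < τ) (hsu : α * s * (1 - α) = (α + β - 1) * u ^ 2)
    (hτv : β * τ * (1 - β) = (α + β - 1) * v ^ 2) :
    YoungBound (volume : Measure ℝ) (volume : Measure ℝ)
      (fun x y => ENNReal.ofReal (Real.exp (-(u * x - v * y) ^ 2 / 2))) α β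
      (ENNReal.ofReal (gaussianYoungConst α β s τ)) := by
  refine .of_lintegral_eq_one hα.1 hβ.1
    (ENNReal.ofReal_pos.2 (gaussianYoungConst_pos hα.1 hβ.1 hαβ hs hτ)).ne'
    fun f g hf hg hf1 hg1 => ?_
  obtain ⟨hfi, hfi1, hf_eq⟩ := integral_toReal_eq_one hf hf1
  obtain ⟨hgi, hgi1, hg_eq⟩ := integral_toReal_eq_one hg hg1
  refine le_of_eq_of_le ?_ (lintegral_gaussianYoung_le_of_integral_eq_one hα hβ hαβ hs hτ hsu hτv
    hf.ennreal_toReal hfi (fun _ => ENNReal.toReal_nonneg) hfi1 hg.ennreal_toReal hgi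
    (fun _ => ENNReal.toReal_nonneg) hgi1)
  rw [Measure.volume_eq_prod, lintegral_prod _ (by fun_prop)]
  refine lintegral_congr_ae (hf_eq.mono fun x hx => lintegral_congr_ae (hg_eq.mono fun y hy => ?_))
  have hxnn := @ENNReal.toReal_nonneg (f x)
  have hynn := @ENNReal.toReal_nonneg (g y)
  dsimp only
  rw [ENNReal.ofReal_mul (by positivity), ENNReal.ofReal_mul (by positivity),
    ← ENNReal.ofReal_rpow_of_nonneg hxnn hα.1.le, ← ENNReal.ofReal_rpow_of_nonneg hynn hβ.1.le,
    hx, hy]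

theorem YoungBound.gaussian {E : Type*} [NormedAddCommGroup E] [InnerProductSpace ℝ E]
    [FiniteDimensional ℝ E] [MeasurableSpace E] [BorelSpace E] (hα : α ∈ Ioo 0 1)
    (hβ : β ∈ Ioo 0 1) (hαβ : 1 < α + β) (hs : 0 < s) (hτ : 0 < τ)
    (hsu : α * s * (1 - α) = (α + β - 1) * u ^ 2) (hτv : β * τ * (1 - β) = (α + β - 1) * v ^ 2) :
    YoungBound (volume : Measure E) (volume : Measure E)
      (fun x y => ENNReal.ofReal (Real.exp (-‖u • x - v • y‖ ^ 2 / 2))) α β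
      (ENNReal.ofReal (gaussianYoungConst α β s τ) ^ Module.finrank ℝ E) := by
  have hpi := (youngBound_gaussian_real hα hβ hαβ hs hτ hsu hτv).pi (by fun_prop)
    (Module.finrank ℝ E)
  let b := stdOrthonormalBasis ℝ E
  have hcoord : MeasurePreserving (b.measurableEquiv.trans
      (MeasurableEquiv.toLp 2 (Fin (Module.finrank ℝ E) → ℝ)).symm) :=
    (EuclideanSpace.volume_preserving_symm_measurableEquiv_toLp _).comp
      b.measurePreserving_measurableEquiv
  have hnorm (x y : E) : ∑ i, (u * b.repr x i - v * b.repr y i) ^ 2 = ‖u • x - v • y‖ ^ 2 := by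
    rw [← b.repr.norm_map, EuclideanSpace.real_norm_sq_eq]
    simp
  have hkernel (x y : E) :
      ∏ i, ENNReal.ofReal (Real.exp (-(u * b.repr x i - v * b.repr y i) ^ 2 / 2)) =
        ENNReal.ofReal (Real.exp (-‖u • x - v • y‖ ^ 2 / 2)) := by
    rw [← ENNReal.ofReal_prod_of_nonneg fun _ _ => (Real.exp_pos _).le, ← Real.exp_sum,
      ← Finset.sum_div, Finset.sum_neg_distrib, hnorm]
  simp only [← hkernel]
  exact (hpi.comp_measurePreserving hcoord hcoord :)

end GaussianYoungInequality

section GaussianKernels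

variable {E : Type*} [NormedAddCommGroup E] [InnerProductSpace ℝ E] {ρ : ℝ}

local notation "d" => (Module.finrank ℝ E : ℝ)

/-- The density of the standard Gaussian measure with respect to Lebesgue measure. -/
noncomputable def stdGaussianPDF (x : E) : ℝ :=
  (2 * Real.pi) ^ (-d / 2) * Real.exp (-‖x‖ ^ 2 / 2)

theorem stdGaussianPDF_pos (x : E) : 0 < stdGaussianPDF x := by
  unfold stdGaussianPDF
  positivity

theorem continuous_stdGaussianPDF : Continuous (stdGaussianPDF : E → ℝ) := by
  unfold stdGaussianPDF
  fun_prop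

/-- The density with respect to `γ` of the Gaussian measure with mean `m` and covariance
`c ^ 2`. -/
noncomputable def gaussianRatio (m : E) (c : ℝ) (y : E) : ℝ :=
  c ^ (-d) * Real.exp (‖y‖ ^ 2 / 2 - ‖y - m‖ ^ 2 / (2 * c ^ 2))

theorem gaussianRatio_pos (m : E) {c : ℝ} (hc : 0 < c) (y : E) : 0 < gaussianRatio m c y := by
  unfold gaussianRatio
  positivity

theorem continuous_gaussianRatio (m : E) (c : ℝ) : Continuous (gaussianRatio m c) := by
  unfold gaussianRatio
  fun_prop

theorem stdGaussianPDF_mul_gaussianRatio (m : E) {c : ℝ} (hc : 0 < c) (y : E) :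
    stdGaussianPDF y * gaussianRatio m c y = c ^ (-d) * stdGaussianPDF (c⁻¹ • (y - m)) := by
  rw [stdGaussianPDF, stdGaussianPDF, gaussianRatio, norm_smul, norm_inv,
    Real.norm_of_nonneg hc.le, mul_mul_mul_comm, ← Real.exp_add]
  ring_nf

/-- The Mehler kernel with correlation `ρ`: the density, with respect to the standard Gaussian
measure, of the law of `ρ x + √(1 - ρ²) Y` for a standard Gaussian `Y`. -/
noncomputable def mehlerKernel (ρ : ℝ) (x y : E) : ℝ :=
  (1 - ρ ^ 2) ^ (-d / 2) *
    Real.exp (-(ρ ^ 2 * ‖x‖ ^ 2 + ρ ^ 2 * ‖y‖ ^ 2 - 2 * ρ * inner ℝ x y) / (2 * (1 - ρ ^ 2)))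

theorem one_sub_sq_pos (hρ : ρ ∈ Ioo 0 1) : 0 < 1 - ρ ^ 2 := by
  nlinarith [hρ.1, hρ.2]

theorem mehlerKernel_pos (hρ : ρ ∈ Ioo 0 1) (x y : E) : 0 < mehlerKernel ρ x y := by
  have := one_sub_sq_pos hρ
  unfold mehlerKernel
  positivity

theorem continuous_mehlerKernel (ρ : ℝ) :
    Continuous (Function.uncurry (mehlerKernel ρ : E → E → ℝ)) := by
  unfold mehlerKernel Function.uncurry
  fun_prop

theorem mehlerKernel_comm (ρ : ℝ) (x y : E) : mehlerKernel ρ x y = mehlerKernel ρ y x := by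
  rw [mehlerKernel, mehlerKernel, real_inner_comm, add_comm (ρ ^ 2 * ‖x‖ ^ 2)]

theorem sqrt_rpow_neg {c : ℝ} (hc : 0 ≤ c) (s : ℝ) : √c ^ (-s) = c ^ (-s / 2) := by
  rw [Real.sqrt_eq_rpow, ← Real.rpow_mul hc]
  ring_nf

theorem gaussianRatio_eq_mehlerKernel (hρ : ρ ∈ Ioo 0 1) (x y : E) :
    gaussianRatio (ρ • x) √(1 - ρ ^ 2) y = mehlerKernel ρ x y := by
  have h := one_sub_sq_pos hρ
  rw [gaussianRatio, mehlerKernel, Real.sq_sqrt h.le, sqrt_rpow_neg h.le, norm_sub_sq_real,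
    real_inner_smul_right, norm_smul, Real.norm_of_nonneg hρ.1.le, real_inner_comm]
  congr 2
  field_simp
  ring

theorem mehlerKernel_mul (hρ : ρ ∈ Ioo 0 1) (x y z : E) :
    mehlerKernel ρ x y * mehlerKernel ρ x z = mehlerKernel (ρ ^ 2) y z *
      gaussianRatio ((ρ / (1 + ρ ^ 2)) • (y + z)) √((1 - ρ ^ 2) / (1 + ρ ^ 2)) x := by
  have hsub := one_sub_sq_pos hρ
  have hadd : 0 < 1 + ρ ^ 2 := by positivity
  have hfactor : 1 - (ρ ^ 2) ^ 2 = (1 - ρ ^ 2) * (1 + ρ ^ 2) := by ring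
  simp only [gaussianRatio, mehlerKernel]
  rw [Real.sq_sqrt (by positivity), sqrt_rpow_neg (by positivity), hfactor,
    mul_mul_mul_comm ((1 - ρ ^ 2) ^ (-d / 2)),
    mul_mul_mul_comm (((1 - ρ ^ 2) * (1 + ρ ^ 2)) ^ (-d / 2)), ← Real.exp_add, ← Real.exp_add]
  congr 1
  · rw [Real.mul_rpow hsub.le hadd.le, Real.div_rpow hsub.le hadd.le]
    have : (1 + ρ ^ 2) ^ (-d / 2) ≠ 0 := by positivity
    field_simp
  · congr 1
    rw [norm_sub_sq_real, real_inner_smul_right, norm_smul, mul_pow, Real.norm_of_nonneg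
      (div_pos hρ.1 hadd).le, norm_add_sq_real, inner_add_right]
    field_simp
    ring

theorem mehlerKernel_le (hρ : ρ ∈ Ioo 0 1) (x y : E) :
    mehlerKernel ρ x y ≤ (1 - ρ ^ 2) ^ (-d / 2) * Real.exp (‖x‖ ^ 2 / 2) := by
  have h := one_sub_sq_pos hρ
  refine mul_le_mul_of_nonneg_left (Real.exp_le_exp.2 ?_) (by positivity)
  rw [div_le_div_iff₀ (by positivity) two_pos]
  have hsq : 0 ≤ ‖ρ • y - x‖ ^ 2 := by positivity
  rw [norm_sub_sq_real, real_inner_smul_left, norm_smul, mul_pow, Real.norm_of_nonneg hρ.1.le,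
    real_inner_comm] at hsq
  nlinarith

theorem mehlerKernel_self (hρ : ρ ∈ Ioo 0 1) (x : E) :
    mehlerKernel ρ x x = (1 - ρ ^ 2) ^ (-d / 2) * Real.exp (ρ / (1 + ρ) * ‖x‖ ^ 2) := by
  have hsub : 0 < 1 - ρ := sub_pos.2 hρ.2
  have hadd : 0 < 1 + ρ := by linarith [hρ.1]
  have hfactor : 1 - ρ ^ 2 = (1 - ρ) * (1 + ρ) := by ring
  rw [mehlerKernel, real_inner_self_eq_norm_sq]
  congr 2
  rw [hfactor]
  field_simp
  ring

theorem mehlerKernel_sq_le_mul_self (hρ : ρ ∈ Ioo 0 1) (x y : E) :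
    mehlerKernel ρ x y ^ 2 ≤ mehlerKernel ρ x x * mehlerKernel ρ y y := by
  have hsub := one_sub_sq_pos hρ
  have hexponent : 2 * (-(ρ ^ 2 * ‖x‖ ^ 2 + ρ ^ 2 * ‖y‖ ^ 2 - 2 * ρ * inner ℝ x y) /
      (2 * (1 - ρ ^ 2))) = ρ / (1 + ρ) * ‖x‖ ^ 2 + ρ / (1 + ρ) * ‖y‖ ^ 2 -
        ρ / (1 - ρ ^ 2) * ‖x - y‖ ^ 2 := by
    have hsub' : 0 < 1 - ρ := sub_pos.2 hρ.2
    have hadd : 0 < 1 + ρ := by linarith [hρ.1]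
    have hfactor : 1 - ρ ^ 2 = (1 - ρ) * (1 + ρ) := by ring
    rw [norm_sub_sq_real, hfactor]
    field_simp
    ring
  have hnonneg : 0 ≤ ρ / (1 - ρ ^ 2) * ‖x - y‖ ^ 2 :=
    mul_nonneg (div_pos hρ.1 hsub).le (sq_nonneg _)
  rw [mehlerKernel_self hρ, mehlerKernel_self hρ, mehlerKernel, mul_pow, mul_mul_mul_comm,
    ← Real.exp_add, ← sq, ← Real.exp_nat_mul, Nat.cast_ofNat, hexponent]
  gcongr
  linarith

end GaussianKernels

section GaussianDensity

variable {E : Type*} [NormedAddCommGroup E] [InnerProductSpace ℝ E] [MeasurableSpace E]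
  [BorelSpace E]

local notation "γ" => stdGaussian E
local notation "d" => (Module.finrank ℝ E : ℝ)

theorem measurable_ofReal_stdGaussianPDF :
    Measurable fun x : E => ENNReal.ofReal (stdGaussianPDF x) :=
  continuous_stdGaussianPDF.measurable.ennreal_ofReal

theorem measurable_ofReal_gaussianRatio (m : E) (c : ℝ) :
    Measurable fun y => ENNReal.ofReal (gaussianRatio m c y) :=
  (continuous_gaussianRatio m c).measurable.ennreal_ofReal

variable [FiniteDimensional ℝ E]

theorem integrable_stdGaussianPDF : Integrable (stdGaussianPDF : E → ℝ) := by
  unfold stdGaussianPDF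
  refine Integrable.const_mul ?_ _
  refine (GaussianFourier.integrable_cexp_neg_mul_sq_norm_add (V := E)
    (b := 1 / 2) (by norm_num) 0 0).norm.congr (ae_of_all _ fun x => ?_)
  simp only [Complex.norm_exp]
  congr 1
  simp [← Complex.ofReal_pow]
  ring

theorem integral_stdGaussianPDF_mul_cexp (t : E) :
    ∫ x : E, (stdGaussianPDF x : ℂ) * Complex.exp (inner ℝ x t * Complex.I) =
      Complex.exp (-‖t‖ ^ 2 / 2) := by
  have hintegrand (x : E) : (stdGaussianPDF x : ℂ) * Complex.exp (inner ℝ x t * Complex.I) =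
      (((2 * Real.pi) ^ (-d / 2) : ℝ) : ℂ) *
        Complex.exp (-(1 / 2) * ‖x‖ ^ 2 + Complex.I * inner ℝ t x) := by
    rw [stdGaussianPDF, Complex.ofReal_mul, Complex.ofReal_exp, mul_assoc, ← Complex.exp_add,
      real_inner_comm]
    congr 2
    push_cast
    ring
  have hnorm : (((2 * Real.pi) ^ (-d / 2) : ℝ) : ℂ) *
      (Real.pi / (1 / 2) : ℂ) ^ (d / 2 : ℂ) = 1 := by
    have hreal : (Real.pi / (1 / 2) : ℂ) ^ (d / 2 : ℂ) =
        (((2 * Real.pi) ^ (d / 2) : ℝ) : ℂ) := by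
      rw [Complex.ofReal_cpow (by positivity)]
      push_cast
      ring_nf
    rw [hreal, ← Complex.ofReal_mul, ← Real.rpow_add (by positivity), neg_div, neg_add_cancel,
      Real.rpow_zero, Complex.ofReal_one]
  simp_rw [hintegrand]
  have hgauss := GaussianFourier.integral_cexp_neg_mul_sq_norm_add (V := E) (b := 1 / 2)
    (by norm_num) Complex.I t
  push_cast at hnorm
  rw [integral_const_mul, hgauss, ← mul_assoc, hnorm, one_mul, Complex.I_sq]
  ring_nf

theorem stdGaussian_eq_withDensity :
    γ = volume.withDensity fun x : E => ENNReal.ofReal (stdGaussianPDF x) := by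
  have := isFiniteMeasure_withDensity_ofReal (integrable_stdGaussianPDF (E := E)).2
  refine Measure.ext_of_charFun (funext fun t => ?_)
  rw [charFun_stdGaussian, charFun_apply, integral_withDensity_eq_integral_toReal_smul
    measurable_ofReal_stdGaussianPDF (ae_of_all _ fun _ => ENNReal.ofReal_lt_top),
    ← integral_stdGaussianPDF_mul_cexp]
  refine integral_congr_ae (ae_of_all _ fun x => ?_)
  simp only [ENNReal.toReal_ofReal (stdGaussianPDF_pos x).le, Complex.real_smul]

theorem lintegral_stdGaussian (H : E → ℝ≥0∞) :
    ∫⁻ x, H x ∂γ = ∫⁻ x : E, ENNReal.ofReal (stdGaussianPDF x) * H x := by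
  rw [stdGaussian_eq_withDensity, lintegral_withDensity_eq_lintegral_mul_non_measurable _
    measurable_ofReal_stdGaussianPDF (ae_of_all _ fun _ => ENNReal.ofReal_lt_top)]
  rfl

instance isOpenPosMeasure_stdGaussian : Measure.IsOpenPosMeasure γ := by
  rw [stdGaussian_eq_withDensity]
  exact (withDensity_absolutelyContinuous' measurable_ofReal_stdGaussianPDF.aemeasurable
    (ae_of_all _ fun x => (ENNReal.ofReal_pos.2 (stdGaussianPDF_pos x)).ne')).isOpenPosMeasure

theorem lintegral_comp_add_smul (m : E) {c : ℝ} (hc : 0 < c) {H : E → ℝ≥0∞} (hH : Measurable H) :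
    ∫⁻ z : E, H (m + c • z) = ENNReal.ofReal (c ^ (-d)) * ∫⁻ y : E, H y := by
  have hmap : ∫⁻ z : E, H (m + c • z) = ∫⁻ y, H (m + y) ∂(volume.map (fun z : E => c • z)) := by
    rw [lintegral_map (by fun_prop) (by fun_prop)]
  rw [hmap, Measure.map_addHaar_smul _ hc.ne', lintegral_smul_measure, lintegral_add_left_eq_self,
    smul_eq_mul, abs_of_pos (by positivity), Real.rpow_neg hc.le, Real.rpow_natCast]

theorem lintegral_stdGaussian_comp_add_smul (m : E) {c : ℝ} (hc : 0 < c) {H : E → ℝ≥0∞}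
    (hH : Measurable H) :
    ∫⁻ z, H (m + c • z) ∂γ = ∫⁻ y, ENNReal.ofReal (gaussianRatio m c y) * H y ∂γ := by
  have hinv (z : E) : c⁻¹ • (m + c • z - m) = z := by
    rw [add_sub_cancel_left, inv_smul_smul₀ hc.ne']
  have hsubst := lintegral_comp_add_smul m hc
    (H := fun y => ENNReal.ofReal (stdGaussianPDF (c⁻¹ • (y - m))) * H y)
    ((measurable_ofReal_stdGaussianPDF.comp (by fun_prop)).mul hH)
  simp only [hinv] at hsubst
  rw [lintegral_stdGaussian, lintegral_stdGaussian, hsubst,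
    ← lintegral_const_mul' _ _ ENNReal.ofReal_ne_top]
  refine lintegral_congr fun y => ?_
  rw [← mul_assoc, ← mul_assoc, ← ENNReal.ofReal_mul (by positivity),
    ← ENNReal.ofReal_mul (stdGaussianPDF_pos y).le, stdGaussianPDF_mul_gaussianRatio m hc]

theorem map_add_smul_stdGaussian (m : E) {c : ℝ} (hc : 0 < c) :
    Measure.map (fun z : E => m + c • z) γ =
      Measure.withDensity γ (fun y => ENNReal.ofReal (gaussianRatio m c y)) := by
  refine Measure.ext_of_lintegral _ fun H hH => ?_
  rw [lintegral_map hH (by fun_prop), lintegral_stdGaussian_comp_add_smul m hc hH,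
    lintegral_withDensity_eq_lintegral_mul _ (measurable_ofReal_gaussianRatio m c) hH]
  rfl

theorem quasiMeasurePreserving_add_smul (m : E) {c : ℝ} (hc : 0 < c) :
    Measure.QuasiMeasurePreserving (fun z : E => m + c • z) γ γ :=
  ⟨by fun_prop, (map_add_smul_stdGaussian m hc).symm ▸ withDensity_absolutelyContinuous _ _⟩

theorem quasiMeasurePreserving_smul {c : ℝ} (hc : 0 < c) :
    Measure.QuasiMeasurePreserving (fun z : E => c • z) γ γ := by
  simpa only [zero_add] using quasiMeasurePreserving_add_smul (0 : E) hc

theorem integral_stdGaussian_comp_add_smul (m : E) {c : ℝ} (hc : 0 < c) {f : E → ℝ}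
    (hf : AEStronglyMeasurable f γ) :
    ∫ z, f (m + c • z) ∂γ = ∫ y, f y * gaussianRatio m c y ∂γ := by
  rw [← integral_map (φ := fun z : E => m + c • z) (by fun_prop)
      (hf.mono_ac (quasiMeasurePreserving_add_smul m hc).absolutelyContinuous),
    map_add_smul_stdGaussian m hc, integral_withDensity_eq_integral_toReal_smul
      (measurable_ofReal_gaussianRatio m c) (ae_of_all _ fun _ => ENNReal.ofReal_lt_top)]
  refine integral_congr_ae (ae_of_all _ fun y => ?_)
  simp only [smul_eq_mul, ENNReal.toReal_ofReal (gaussianRatio_pos m hc y).le, mul_comm]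

theorem integrable_stdGaussian_comp_add_smul (m : E) {c : ℝ} (hc : 0 < c) {f : E → ℝ}
    (hf : AEStronglyMeasurable f γ) :
    Integrable (fun z => f (m + c • z)) γ ↔ Integrable (fun y => f y * gaussianRatio m c y) γ := by
  have hmap := integrable_map_measure (f := fun z : E => m + c • z)
    (hf.mono_ac (quasiMeasurePreserving_add_smul m hc).absolutelyContinuous) (by fun_prop)
  rw [map_add_smul_stdGaussian m hc, integrable_withDensity_iff_integrable_smul'
    (measurable_ofReal_gaussianRatio m c) (ae_of_all _ fun _ => ENNReal.ofReal_lt_top)] at hmap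
  refine hmap.symm.trans (integrable_congr (ae_of_all _ fun y => ?_))
  simp only [smul_eq_mul, ENNReal.toReal_ofReal (gaussianRatio_pos m hc y).le, mul_comm]

theorem lintegral_gaussianRatio (m : E) {c : ℝ} (hc : 0 < c) :
    ∫⁻ y, ENNReal.ofReal (gaussianRatio m c y) ∂γ = 1 := by
  simpa using (lintegral_stdGaussian_comp_add_smul m hc (H := 1) measurable_one).symm

theorem integrable_gaussianRatio (m : E) {c : ℝ} (hc : 0 < c) :
    Integrable (gaussianRatio m c) γ := by
  refine (lintegral_ofReal_ne_top_iff_integrable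
    (continuous_gaussianRatio m c).aestronglyMeasurable
    (ae_of_all _ fun y => (gaussianRatio_pos m hc y).le)).1 ?_
  rw [lintegral_gaussianRatio m hc]
  exact ENNReal.one_ne_top

theorem lintegral_exp_norm_sq_mul {c : ℝ} (hc : 0 < c) {H : E → ℝ≥0∞} (hH : Measurable H) :
    ∫⁻ x, ENNReal.ofReal (Real.exp ((1 - (c ^ 2)⁻¹) * (‖x‖ ^ 2 / 2))) * H x ∂γ =
      ENNReal.ofReal (c ^ d) * ∫⁻ x, H (c • x) ∂γ := by
  have hsubst := lintegral_stdGaussian_comp_add_smul 0 hc hH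
  simp only [zero_add] at hsubst
  rw [hsubst, ← lintegral_const_mul' _ _ ENNReal.ofReal_ne_top]
  refine lintegral_congr fun y => ?_
  rw [← mul_assoc, ← ENNReal.ofReal_mul (by positivity), gaussianRatio, ← mul_assoc,
    ← Real.rpow_add hc, add_neg_cancel, Real.rpow_zero, one_mul, sub_zero]
  ring_nf

end GaussianDensity

section MehlerKernel

theorem lintegral_sq_lintegral_kernel {α β : Type*} [MeasurableSpace α] [MeasurableSpace β]
    {μ : Measure α} {ν : Measure β} [SFinite μ] [SFinite ν] {K : α → β → ℝ≥0∞}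
    (hK : Measurable (Function.uncurry K)) {f : β → ℝ≥0∞} (hf : Measurable f) :
    ∫⁻ x, (∫⁻ y, K x y * f y ∂ν) ^ 2 ∂μ =
      ∫⁻ y, ∫⁻ z, f y * f z * ∫⁻ x, K x y * K x z ∂μ ∂ν ∂ν := by
  have hK' {δ : Type _} [MeasurableSpace δ] {u : δ → α} {v : δ → β} (hu : Measurable u)
      (hv : Measurable v) : Measurable fun w => K (u w) (v w) := hK.comp (hu.prodMk hv)
  calc ∫⁻ x, (∫⁻ y, K x y * f y ∂ν) ^ 2 ∂μ
      = ∫⁻ x, ∫⁻ y, ∫⁻ z, f y * f z * (K x y * K x z) ∂ν ∂ν ∂μ := by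
        refine lintegral_congr fun x => ?_
        have hKx : Measurable (K x) := hK' measurable_const measurable_id
        rw [sq, ← lintegral_mul_const _ (by fun_prop)]
        refine lintegral_congr fun y => ?_
        rw [← lintegral_const_mul _ (by fun_prop)]
        exact lintegral_congr fun z => by ring
    _ = ∫⁻ y, ∫⁻ x, ∫⁻ z, f y * f z * (K x y * K x z) ∂ν ∂μ ∂ν :=
        lintegral_lintegral_swap (Measurable.lintegral_prod_right'
          (f := fun u : (α × β) × β => f u.1.2 * f u.2 * (K u.1.1 u.1.2 * K u.1.1 u.2))
          (by fun_prop)).aemeasurable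
    _ = ∫⁻ y, ∫⁻ z, ∫⁻ x, f y * f z * (K x y * K x z) ∂μ ∂ν ∂ν :=
        lintegral_congr fun y => lintegral_lintegral_swap (by fun_prop)
    _ = ∫⁻ y, ∫⁻ z, f y * f z * ∫⁻ x, K x y * K x z ∂μ ∂ν ∂ν :=
        lintegral_congr fun y => lintegral_congr fun z => lintegral_const_mul _ (by fun_prop)

variable {E : Type*} [NormedAddCommGroup E] [InnerProductSpace ℝ E] [MeasurableSpace E]
  [BorelSpace E] [FiniteDimensional ℝ E] {ρ : ℝ}

local notation "γ" => stdGaussian E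

theorem measurable_ofReal_mehlerKernel (ρ : ℝ) :
    Measurable (Function.uncurry fun x y : E => ENNReal.ofReal (mehlerKernel ρ x y)) :=
  (continuous_mehlerKernel ρ).measurable.ennreal_ofReal

theorem lintegral_mehlerKernel_mul (hρ : ρ ∈ Ioo 0 1) (y z : E) :
    ∫⁻ x, ENNReal.ofReal (mehlerKernel ρ x y) * ENNReal.ofReal (mehlerKernel ρ x z) ∂γ =
      ENNReal.ofReal (mehlerKernel (ρ ^ 2) y z) := by
  have hsub := one_sub_sq_pos hρ
  have hsq : ρ ^ 2 ∈ Ioo (0 : ℝ) 1 := ⟨pow_pos hρ.1 2, by linarith⟩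
  simp_rw [← ENNReal.ofReal_mul (mehlerKernel_pos hρ _ y).le, mehlerKernel_mul hρ,
    ENNReal.ofReal_mul (mehlerKernel_pos hsq y z).le]
  rw [lintegral_const_mul' _ _ ENNReal.ofReal_ne_top, lintegral_gaussianRatio _ (by positivity),
    mul_one]

theorem lintegral_comp_mehler (hρ : ρ ∈ Ioo 0 1) (x : E) {f : E → ℝ≥0∞} (hf : Measurable f) :
    ∫⁻ z, f (ρ • x + √(1 - ρ ^ 2) • z) ∂γ =
      ∫⁻ y, ENNReal.ofReal (mehlerKernel ρ x y) * f y ∂γ := by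
  rw [lintegral_stdGaussian_comp_add_smul _ (Real.sqrt_pos.2 (one_sub_sq_pos hρ)) hf]
  simp_rw [gaussianRatio_eq_mehlerKernel hρ]

theorem integrable_mehlerKernel (hρ : ρ ∈ Ioo 0 1) (x : E) : Integrable (mehlerKernel ρ x) γ :=
  (integrable_gaussianRatio (ρ • x) (Real.sqrt_pos.2 (one_sub_sq_pos hρ))).congr
    (ae_of_all _ (gaussianRatio_eq_mehlerKernel hρ x))

theorem lintegral_sq_mehlerKernel (hρ : ρ ∈ Ioo 0 1) {f : E → ℝ≥0∞} (hf : Measurable f) :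
    ∫⁻ x, (∫⁻ y, ENNReal.ofReal (mehlerKernel ρ x y) * f y ∂γ) ^ 2 ∂γ =
      ∫⁻ y, ∫⁻ z, f y * f z * ENNReal.ofReal (mehlerKernel (ρ ^ 2) y z) ∂γ ∂γ := by
  rw [lintegral_sq_lintegral_kernel (measurable_ofReal_mehlerKernel ρ) hf]
  simp_rw [lintegral_mehlerKernel_mul hρ]

end MehlerKernel

section Semigroup

variable {n : ℕ} {t : ℝ}

local notation "𝔼" => EuclideanSpace ℝ (Fin n)
local notation "γ" => stdGaussian (EuclideanSpace ℝ (Fin n))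

theorem exp_neg_mem_Ioo (ht : 0 < t) : Real.exp (-t) ∈ Ioo 0 1 :=
  ⟨Real.exp_pos _, Real.exp_lt_one_iff.2 (neg_neg_of_pos ht)⟩

theorem exp_neg_two_mul (t : ℝ) : Real.exp (-2 * t) = Real.exp (-t) ^ 2 := by
  rw [← Real.exp_nat_mul]
  push_cast
  ring_nf

theorem mehlerPoint_eq (t : ℝ) (x y : 𝔼) :
    mehlerPoint t x y = Real.exp (-t) • x + √(1 - Real.exp (-t) ^ 2) • y := by
  rw [mehlerPoint, exp_neg_two_mul]

theorem quasiMeasurePreserving_mehlerPoint (ht : 0 < t) (x : 𝔼) :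
    Measure.QuasiMeasurePreserving (mehlerPoint t x) γ γ := by
  rw [funext (mehlerPoint_eq t x)]
  exact quasiMeasurePreserving_add_smul _ (Real.sqrt_pos.2 (one_sub_sq_pos (exp_neg_mem_Ioo ht)))

theorem ouSemigroup_congr_ae (ht : 0 < t) {f g : 𝔼 → ℝ} (hfg : f =ᵐ[γ] g) :
    ouSemigroup t f = ouSemigroup t g :=
  funext fun x => integral_congr_ae ((quasiMeasurePreserving_mehlerPoint ht x).ae_eq hfg)

theorem measurable_ouSemigroup (t : ℝ) {f : 𝔼 → ℝ} (hf : Measurable f) :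
    Measurable (ouSemigroup t f) := by
  refine (StronglyMeasurable.integral_prod_right'
    (f := fun u : 𝔼 × 𝔼 => f (mehlerPoint t u.1 u.2)) ?_).measurable
  unfold mehlerPoint
  exact Measurable.stronglyMeasurable (by fun_prop)

theorem aestronglyMeasurable_ouSemigroup (ht : 0 < t) {f : 𝔼 → ℝ}
    (hf : AEStronglyMeasurable f γ) : AEStronglyMeasurable (ouSemigroup t f) γ := by
  rw [ouSemigroup_congr_ae ht hf.ae_eq_mk]
  exact (measurable_ouSemigroup t hf.stronglyMeasurable_mk.measurable).aestronglyMeasurable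

theorem ouSemigroup_eq_integral (ht : 0 < t) {f : 𝔼 → ℝ} (hf : AEStronglyMeasurable f γ)
    (x : 𝔼) : ouSemigroup t f x = ∫ y, f y * mehlerKernel (Real.exp (-t)) x y ∂γ := by
  have hρ := exp_neg_mem_Ioo ht
  simp_rw [ouSemigroup, mehlerPoint_eq, ← gaussianRatio_eq_mehlerKernel hρ]
  exact integral_stdGaussian_comp_add_smul _ (Real.sqrt_pos.2 (one_sub_sq_pos hρ)) hf

theorem integrable_comp_mehlerPoint_iff (ht : 0 < t) {f : 𝔼 → ℝ}
    (hf : AEStronglyMeasurable f γ) (x : 𝔼) : Integrable (fun y => f (mehlerPoint t x y)) γ ↔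
      Integrable (fun y => f y * mehlerKernel (Real.exp (-t)) x y) γ := by
  have hρ := exp_neg_mem_Ioo ht
  simp_rw [mehlerPoint_eq, ← gaussianRatio_eq_mehlerKernel hρ]
  exact integrable_stdGaussian_comp_add_smul _ (Real.sqrt_pos.2 (one_sub_sq_pos hρ)) hf

theorem integrable_comp_mehlerPoint (ht : 0 < t) {f : 𝔼 → ℝ} (hf : Integrable f γ) (x : 𝔼) :
    Integrable (fun y => f (mehlerPoint t x y)) γ := by
  have hρ := exp_neg_mem_Ioo ht
  rw [integrable_comp_mehlerPoint_iff ht hf.aestronglyMeasurable]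
  exact hf.mul_bdd (integrable_mehlerKernel hρ x).aestronglyMeasurable (ae_of_all _ fun y =>
    (Real.norm_of_nonneg (mehlerKernel_pos hρ x y).le).trans_le (mehlerKernel_le hρ x y))

theorem enorm_ouSemigroup_le (ht : 0 < t) {f : 𝔼 → ℝ} (hf : Measurable f) (x : 𝔼) :
    ‖ouSemigroup t f x‖ₑ ≤
      ∫⁻ y, ENNReal.ofReal (mehlerKernel (Real.exp (-t)) x y) * ‖f y‖ₑ ∂γ := by
  rw [← lintegral_comp_mehler (exp_neg_mem_Ioo ht) x hf.enorm]
  simp_rw [← mehlerPoint_eq]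
  exact enorm_integral_le_lintegral_enorm _

theorem enorm_ouSemigroup_of_nonneg (ht : 0 < t) {f : 𝔼 → ℝ} (hf : Measurable f)
    (hint : Integrable f γ) (hnonneg : ∀ y, 0 ≤ f y) (x : 𝔼) : ‖ouSemigroup t f x‖ₑ =
      ∫⁻ y, ENNReal.ofReal (mehlerKernel (Real.exp (-t)) x y) * ‖f y‖ₑ ∂γ := by
  rw [← lintegral_comp_mehler (exp_neg_mem_Ioo ht) x hf.enorm]
  simp_rw [← mehlerPoint_eq]
  rw [ouSemigroup, Real.enorm_of_nonneg (integral_nonneg fun y => hnonneg _),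
    ofReal_integral_eq_lintegral_ofReal (integrable_comp_mehlerPoint ht hint x)
      (ae_of_all _ fun y => hnonneg _)]
  simp_rw [Real.enorm_of_nonneg (hnonneg _)]

theorem isOUKernel_mehlerKernel (ht : 0 < t) :
    IsOUKernel (n := n) t (mehlerKernel (Real.exp (-t))) where
  continuous := continuous_mehlerKernel _
  integrable := integrable_mehlerKernel (exp_neg_mem_Ioo ht)
  repr _ hf _ x := ouSemigroup_eq_integral ht hf.aestronglyMeasurable x

theorem IsOUKernel.unique {k l : 𝔼 → 𝔼 → ℝ} (hk : IsOUKernel t k) (hl : IsOUKernel t l) :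
    k = l := by
  funext x
  have hcont {j : 𝔼 → 𝔼 → ℝ} (hj : IsOUKernel t j) : Continuous (j x) :=
    hj.continuous.comp (Continuous.prodMk_right x)
  have hindicator {j : 𝔼 → 𝔼 → ℝ} (hj : IsOUKernel t j) {s : Set 𝔼} (hs : MeasurableSet s) :
      ∫ y in s, j x y ∂γ = ouSemigroup t (s.indicator 1) x := by
    rw [hj.repr _ (measurable_one.indicator hs) ⟨1, fun y => ?_⟩, ← integral_indicator hs]
    · exact integral_congr_ae (ae_of_all _ fun y => by by_cases hy : y ∈ s <;> simp [hy])
    · by_cases hy : y ∈ s <;> simp [hy]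
  refine ((hcont hk).ae_eq_iff_eq γ (hcont hl)).1
    ((hk.integrable x).ae_eq_of_forall_setIntegral_eq _ _ (hl.integrable x) fun s hs _ => ?_)
  rw [hindicator hk hs, hindicator hl hs]

end Semigroup

section WeightedBound

variable {n : ℕ} {t : ℝ}

local notation "𝔼" => EuclideanSpace ℝ (Fin n)
local notation "γ" => stdGaussian (EuclideanSpace ℝ (Fin n))

theorem eLpNorm_two_sq {Ω : Type*} [MeasurableSpace Ω] {μ : Measure Ω} (f : Ω → ℝ) :
    eLpNorm f 2 μ ^ 2 = ∫⁻ x, ‖f x‖ₑ ^ 2 ∂μ := by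
  simpa using eLpNorm_nnreal_pow_eq_lintegral (f := f) (p := 2) (μ := μ) two_ne_zero

theorem sq_mem_Ioo {ρ : ℝ} (hρ : ρ ∈ Ioo 0 1) : ρ ^ 2 ∈ Ioo (0 : ℝ) 1 :=
  ⟨pow_pos hρ.1 2, sub_pos.1 (one_sub_sq_pos hρ)⟩

theorem ouWeight_eq (t : ℝ) (y : 𝔼) : ouWeight t y =
    (1 - (Real.exp (-t) ^ 2) ^ 2) ^ (-(n : ℝ) / 4) *
      Real.exp ((1 - (1 + Real.exp (-t) ^ 2)⁻¹) * (‖y‖ ^ 2 / 2)) := by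
  have hquartic : Real.exp (-4 * t) = (Real.exp (-t) ^ 2) ^ 2 := by
    rw [← pow_mul, ← Real.exp_nat_mul]
    push_cast
    ring_nf
  have hinv : Real.exp (2 * t) = (Real.exp (-t) ^ 2)⁻¹ := by
    rw [← Real.exp_nat_mul, ← Real.exp_neg]
    push_cast
    ring_nf
  rw [ouWeight, hquartic, hinv]
  congr 2
  have := Real.exp_pos (-t)
  field_simp
  ring

theorem continuous_ouWeight (t : ℝ) : Continuous (ouWeight t : 𝔼 → ℝ) := by
  unfold ouWeight
  fun_prop

theorem ouWeight_pos (ht : 0 < t) (y : 𝔼) : 0 < ouWeight t y := by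
  have := one_sub_sq_pos (sq_mem_Ioo (exp_neg_mem_Ioo ht))
  rw [ouWeight_eq]
  positivity

theorem one_le_ouWeight (ht : 0 < t) (y : 𝔼) : 1 ≤ ouWeight t y := by
  have := one_sub_sq_pos (sq_mem_Ioo (exp_neg_mem_Ioo ht))
  have : 0 ≤ 1 / (1 + Real.exp (2 * t)) := by positivity
  have hquartic : Real.exp (-4 * t) < 1 := Real.exp_lt_one_iff.2 (by linarith)
  exact one_le_mul_of_one_le_of_one_le
    (Real.one_le_rpow_of_pos_of_le_one_of_nonpos (sub_pos.2 hquartic)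
      (sub_le_self _ (Real.exp_pos _).le) (by rw [neg_div]; exact neg_nonpos.2 (by positivity)))
    (Real.one_le_exp (by positivity))

theorem ouWeight_sq (ht : 0 < t) (x : 𝔼) :
    ouWeight t x ^ 2 = mehlerKernel (Real.exp (-t) ^ 2) x x := by
  have hsq := sq_mem_Ioo (exp_neg_mem_Ioo ht)
  rw [ouWeight_eq]
  generalize Real.exp (-t) ^ 2 = r at hsq
  have hadd : 0 < 1 + r := by linarith [hsq.1]
  rw [mehlerKernel_self hsq, mul_pow, ← Real.rpow_mul_natCast (one_sub_sq_pos hsq).le,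
    ← Real.exp_nat_mul, finrank_euclideanSpace_fin]
  push_cast
  congr 2
  · ring
  · field_simp
    ring

theorem mehlerKernel_sq_le_ouWeight_mul (ht : 0 < t) (x y : 𝔼) :
    mehlerKernel (Real.exp (-t) ^ 2) x y ≤ ouWeight t x * ouWeight t y := by
  have hsq := sq_mem_Ioo (exp_neg_mem_Ioo ht)
  have hpos := mul_pos (ouWeight_pos ht x) (ouWeight_pos ht y)
  refine le_of_sq_le_sq ?_ hpos.le
  rw [mul_pow, ouWeight_sq ht, ouWeight_sq ht]
  exact mehlerKernel_sq_le_mul_self hsq x y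

theorem lintegral_sq_mehlerKernel_le (ht : 0 < t) {f : 𝔼 → ℝ≥0∞} (hf : Measurable f) :
    ∫⁻ x, (∫⁻ y, ENNReal.ofReal (mehlerKernel (Real.exp (-t)) x y) * f y ∂γ) ^ 2 ∂γ ≤
      (∫⁻ y, f y * ENNReal.ofReal (ouWeight t y) ∂γ) ^ 2 := by
  have hmeas : Measurable fun y : 𝔼 => f y * ENNReal.ofReal (ouWeight t y) :=
    hf.mul (continuous_ouWeight t).measurable.ennreal_ofReal
  rw [lintegral_sq_mehlerKernel (exp_neg_mem_Ioo ht) hf, sq (∫⁻ y, f y * _ ∂γ),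
    ← lintegral_mul_const _ hmeas]
  refine lintegral_mono fun y => ?_
  rw [← lintegral_const_mul _ hmeas]
  refine lintegral_mono fun z => ?_
  calc f y * f z * ENNReal.ofReal (mehlerKernel (Real.exp (-t) ^ 2) y z)
      ≤ f y * f z * ENNReal.ofReal (ouWeight t y * ouWeight t z) := by
        gcongr
        exact mehlerKernel_sq_le_ouWeight_mul ht y z
    _ = f y * ENNReal.ofReal (ouWeight t y) * (f z * ENNReal.ofReal (ouWeight t z)) := by
        rw [ENNReal.ofReal_mul (ouWeight_pos ht y).le]
        ring

theorem eLpNorm_two_ouSemigroup_le (ht : 0 < t) {f : 𝔼 → ℝ} (hf : AEStronglyMeasurable f γ) :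
    eLpNorm (ouSemigroup t f) 2 γ ≤ ∫⁻ y, ‖f y‖ₑ * ENNReal.ofReal (ouWeight t y) ∂γ := by
  wlog hmeas : Measurable f generalizing f
  · have hmk := this hf.stronglyMeasurable_mk.aestronglyMeasurable
      hf.stronglyMeasurable_mk.measurable
    rw [ouSemigroup_congr_ae ht hf.ae_eq_mk]
    refine hmk.trans_eq (lintegral_congr_ae ?_)
    filter_upwards [hf.ae_eq_mk] with x hx
    rw [hx]
  refine (ENNReal.pow_le_pow_left_iff two_ne_zero).1 ?_
  rw [eLpNorm_two_sq]
  exact (lintegral_mono fun x => pow_le_pow_left' (enorm_ouSemigroup_le ht hmeas x) 2).trans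
    (lintegral_sq_mehlerKernel_le ht hmeas.enorm)

theorem integrable_of_integrable_mul_ouWeight (ht : 0 < t) {f : 𝔼 → ℝ}
    (hf : AEStronglyMeasurable f γ) (h : Integrable (fun y => f y * ouWeight t y) γ) :
    Integrable f γ := by
  refine h.mono hf (ae_of_all _ fun y => ?_)
  rw [norm_mul]
  exact le_mul_of_one_le_right (norm_nonneg _) ((one_le_ouWeight ht y).trans (le_abs_self _))

theorem dilation_congr_ae (a : ℝ) {f g : 𝔼 → ℝ} (hfg : f =ᵐ[γ] g) :
    dilation a f =ᵐ[γ] dilation a g :=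
  (quasiMeasurePreserving_smul (Real.exp_pos (a / 2))).ae_eq hfg

theorem div_rpow_eq_rpow_mul_rpow {r c : ℝ} (hr : 0 < r) (hr' : r < 1) (hc : 0 ≤ c)
    (hc_sq : c ^ 2 = 1 + r) (s : ℝ) :
    ((r + 1) / (1 - r)) ^ (s / 4) = (1 - r ^ 2) ^ (-s / 4) * c ^ s := by
  have hadd : 0 < 1 + r := by positivity
  have hsub : 0 < 1 - r := sub_pos.2 hr'
  have hfactor : 1 - r ^ 2 = (1 - r) * (1 + r) := by ring
  have hc_rpow : c ^ s = (1 + r) ^ (s / 2) := by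
    rw [← hc_sq, ← Real.rpow_natCast_mul hc, Nat.cast_two, mul_div_cancel₀ _ two_ne_zero]
  rw [hc_rpow, hfactor, Real.mul_rpow hsub.le hadd.le, mul_assoc, ← Real.rpow_add hadd,
    Real.div_rpow (by positivity) hsub.le, neg_div, Real.rpow_neg hsub.le, add_comm r,
    div_eq_inv_mul]
  ring_nf

theorem eLpNorm_dilation_eq_lintegral_ouWeight (ht : 0 < t) {f : 𝔼 → ℝ}
    (hf : AEStronglyMeasurable f γ) :
    ENNReal.ofReal (((Real.exp (-2 * t) + 1) / (1 - Real.exp (-2 * t))) ^ ((n : ℝ) / 4)) *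
        eLpNorm (dilation (Real.log (Real.exp (-2 * t) + 1)) f) 1 γ =
      ∫⁻ y, ‖f y‖ₑ * ENNReal.ofReal (ouWeight t y) ∂γ := by
  wlog hmeas : Measurable f generalizing f
  · rw [eLpNorm_congr_ae (dilation_congr_ae _ hf.ae_eq_mk),
      this hf.stronglyMeasurable_mk.aestronglyMeasurable hf.stronglyMeasurable_mk.measurable]
    refine lintegral_congr_ae ?_
    filter_upwards [hf.ae_eq_mk] with y hy
    rw [← hy]
  obtain ⟨hr, hr'⟩ := sq_mem_Ioo (exp_neg_mem_Ioo ht)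
  rw [exp_neg_two_mul, eLpNorm_one_eq_lintegral_enorm]
  simp_rw [dilation, ouWeight_eq]
  set r := Real.exp (-t) ^ 2
  set c := Real.exp (Real.log (r + 1) / 2) with hc
  have hc_sq : c ^ 2 = 1 + r := by
    rw [hc, ← Real.exp_nat_mul, Nat.cast_two, mul_div_cancel₀ _ two_ne_zero,
      Real.exp_log (by positivity), add_comm]
  have hconst := div_rpow_eq_rpow_mul_rpow hr hr' (Real.exp_pos _).le hc_sq n
  have hsubst := lintegral_exp_norm_sq_mul (Real.exp_pos (Real.log (r + 1) / 2)) hmeas.enorm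
  rw [hc_sq, finrank_euclideanSpace_fin] at hsubst
  have hpos : 0 ≤ (1 - r ^ 2) ^ (-(n : ℝ) / 4) := Real.rpow_nonneg (by nlinarith) _
  rw [hconst, ENNReal.ofReal_mul hpos, mul_assoc, ← hsubst,
    ← lintegral_const_mul' _ _ ENNReal.ofReal_ne_top]
  refine lintegral_congr fun y => ?_
  rw [ENNReal.ofReal_mul hpos]
  ring

theorem exists_const_lt_of_not_ae_le {Ω : Type*} [MeasurableSpace Ω] {μ : Measure Ω}
    {V W : Ω → ℝ≥0∞} (h : ¬ W ≤ᵐ[μ] V) : ∃ q : ℝ≥0∞, q ≠ ∞ ∧ μ {x | V x < q ∧ q < W x} ≠ 0 := by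
  by_contra! hnull
  refine h (ae_iff.2 (measure_mono_null (fun x hx => ?_)
    (measure_iUnion_null fun q : ℚ => hnull (ENNReal.ofReal q) ENNReal.ofReal_ne_top)))
  obtain ⟨q, -, hVq, hqW⟩ := ENNReal.lt_iff_exists_rat_btwn.1 (not_le.1 hx)
  exact mem_iUnion.2 ⟨q, hVq, hqW⟩

theorem setLIntegral_setLIntegral_const {Ω : Type*} [MeasurableSpace Ω] {μ : Measure Ω}
    (B : Set Ω) (q : ℝ≥0∞) : ∫⁻ _ in B, ∫⁻ _ in B, q ^ 2 ∂μ ∂μ = (q * μ B) ^ 2 := by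
  simp only [setLIntegral_const]
  ring

/-- Around a Lebesgue-typical point where the inequality fails, both sides of the hypothesis are
nearly constant on a small set `B`. -/
theorem ae_le_of_forall_setLIntegral_kernel_le {Ω : Type*} [TopologicalSpace Ω]
    [SecondCountableTopology Ω] [MeasurableSpace Ω] [OpensMeasurableSpace Ω] {μ : Measure Ω}
    [IsFiniteMeasure μ] {K : Ω → Ω → ℝ≥0∞} (hK : Continuous (Function.uncurry K))
    {W : Ω → ℝ≥0∞} (hW : Measurable W) (hWK : ∀ x, K x x = W x ^ 2)
    {V : Ω → ℝ≥0∞} (hV : Measurable V)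
    (h : ∀ B, MeasurableSet B → ∫⁻ x in B, ∫⁻ y in B, K x y ∂μ ∂μ ≤ (∫⁻ x in B, V x ∂μ) ^ 2) :
    W ≤ᵐ[μ] V := by
  by_contra hnot
  obtain ⟨q, hq, hpos⟩ := exists_const_lt_of_not_ae_le hnot
  set S := {x | V x < q ∧ q < W x}
  have hS : MeasurableSet S :=
    (measurableSet_lt hV measurable_const).inter (measurableSet_lt measurable_const hW)
  obtain ⟨x₀, hx₀, hnhds⟩ := exists_mem_forall_mem_nhdsWithin_pos_measure hpos
  have hdiag : q ^ 2 < Function.uncurry K (x₀, x₀) := by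
    rw [Function.uncurry_apply_pair, hWK]
    exact ENNReal.pow_lt_pow_left two_ne_zero hx₀.2
  obtain ⟨N, hN, hNK⟩ : ∃ N ∈ 𝓝 x₀, ∀ x ∈ N, ∀ y ∈ N, q ^ 2 < K x y :=
    eventually_prod_self_iff'.1
      (nhds_prod_eq (x := x₀) (y := x₀) ▸ hK.continuousAt.eventually (lt_mem_nhds hdiag))
  obtain ⟨U, hUN, hU, hxU⟩ := mem_nhds_iff.1 hN
  set B := U ∩ S
  have hB : MeasurableSet B := hU.measurableSet.inter hS
  have hBpos : μ B ≠ 0 :=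
    (hnhds B (inter_mem (mem_nhdsWithin_of_mem_nhds (hU.mem_nhds hxU)) self_mem_nhdsWithin)).ne'
  have hlower : (q * μ B) ^ 2 ≤ ∫⁻ x in B, ∫⁻ y in B, K x y ∂μ ∂μ := by
    rw [← setLIntegral_setLIntegral_const]
    exact setLIntegral_mono' hB fun x hx => setLIntegral_mono' hB fun y hy =>
      (hNK x (hUN hx.1) y (hUN hy.1)).le
  have hupper : ∫⁻ x in B, V x ∂μ < q * μ B := by
    rw [← setLIntegral_const]
    refine setLIntegral_strict_mono hB hBpos measurable_const ?_ (ae_of_all _ fun x hx => hx.2.1)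
    refine ((setLIntegral_mono' hB fun x hx => hx.2.1.le).trans_lt ?_).ne
    rw [setLIntegral_const]
    exact ENNReal.mul_lt_top hq.lt_top (measure_lt_top _ _)
  exact hupper.not_ge ((ENNReal.pow_le_pow_left_iff two_ne_zero).1 (hlower.trans (h B hB)))

theorem eLpNorm_two_ouSemigroup_indicator_sq (ht : 0 < t) {B : Set 𝔼} (hB : MeasurableSet B) :
    eLpNorm (ouSemigroup t (B.indicator 1)) 2 γ ^ 2 =
      ∫⁻ y in B, ∫⁻ z in B, ENNReal.ofReal (mehlerKernel (Real.exp (-t) ^ 2) y z) ∂γ ∂γ := by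
  have hmeas : Measurable (B.indicator (1 : 𝔼 → ℝ)) := measurable_one.indicator hB
  rw [eLpNorm_two_sq]
  simp_rw [enorm_ouSemigroup_of_nonneg ht hmeas ((integrable_const 1).indicator hB)
    (indicator_nonneg fun _ _ => zero_le_one)]
  rw [lintegral_sq_mehlerKernel (exp_neg_mem_Ioo ht) hmeas.enorm, ← lintegral_indicator hB]
  refine lintegral_congr fun y => ?_
  by_cases hy : y ∈ B
  · rw [indicator_of_mem hy, indicator_of_mem hy, ← lintegral_indicator hB]
    refine lintegral_congr fun z => ?_
    by_cases hz : z ∈ B <;> simp [hz]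
  · simp [hy]

theorem ouWeight_ae_le_of_eLpNorm_two_le (ht : 0 < t) {V : 𝔼 → ℝ≥0∞} (hV : Measurable V)
    (h : ∀ f : 𝔼 → ℝ, Measurable f → (∃ C : ℝ, ∀ x, |f x| ≤ C) →
      eLpNorm (ouSemigroup t f) 2 γ ≤ ∫⁻ y, ‖f y‖ₑ * V y ∂γ) :
    ∀ᵐ y ∂γ, ENNReal.ofReal (ouWeight t y) ≤ V y := by
  refine ae_le_of_forall_setLIntegral_kernel_le
    (K := fun x y => ENNReal.ofReal (mehlerKernel (Real.exp (-t) ^ 2) x y))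
    (ENNReal.continuous_ofReal.comp (continuous_mehlerKernel _))
    (continuous_ouWeight t).measurable.ennreal_ofReal
    (fun x => by rw [← ouWeight_sq ht, ENNReal.ofReal_pow (ouWeight_pos ht x).le]) hV
    fun B hB => ?_
  rw [← eLpNorm_two_ouSemigroup_indicator_sq ht hB, ← lintegral_indicator hB]
  refine pow_le_pow_left' ((h _ (measurable_one.indicator hB) ⟨1, fun x => ?_⟩).trans_eq
    (lintegral_congr fun x => ?_)) 2
  all_goals by_cases hx : x ∈ B <;> simp [hx]

end WeightedBound

section KernelTrace

variable {E : Type*} [NormedAddCommGroup E] [InnerProductSpace ℝ E] [MeasurableSpace E]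
  [BorelSpace E] [FiniteDimensional ℝ E] {ρ : ℝ}

local notation "γ" => stdGaussian E
local notation "d" => Module.finrank ℝ E

theorem lintegral_mehlerKernel_self (hρ : ρ ∈ Ioo 0 1) :
    ∫⁻ x : E, ENNReal.ofReal (mehlerKernel ρ x x) ∂γ = ENNReal.ofReal ((1 - ρ) ^ d)⁻¹ := by
  have hsub : 0 < 1 - ρ := sub_pos.2 hρ.2
  have hadd : 0 < 1 + ρ := by linarith [hρ.1]
  have hfactor : 1 - ρ ^ 2 = (1 - ρ) * (1 + ρ) := by ring
  have hc : 0 < √((1 + ρ) / (1 - ρ)) := by positivity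
  have hdensity (x : E) : mehlerKernel ρ x x = (1 - ρ ^ 2) ^ (-(d : ℝ) / 2) *
      Real.exp ((1 - (√((1 + ρ) / (1 - ρ)) ^ 2)⁻¹) * (‖x‖ ^ 2 / 2)) := by
    rw [mehlerKernel_self hρ, Real.sq_sqrt (by positivity)]
    congr 2
    field_simp
    ring
  have hconst : (1 - ρ ^ 2) ^ (-(d : ℝ) / 2) * √((1 + ρ) / (1 - ρ)) ^ (d : ℝ) =
      ((1 - ρ) ^ d)⁻¹ := by
    rw [← sqrt_rpow_neg (one_sub_sq_pos hρ).le, Real.rpow_neg (by positivity), ← Real.inv_rpow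
      (by positivity), ← Real.mul_rpow (by positivity) (by positivity), ← Real.sqrt_inv,
      ← Real.sqrt_mul (by rw [hfactor]; positivity), Real.rpow_natCast, ← inv_pow]
    congr 1
    rw [hfactor, Real.sqrt_eq_iff_mul_self_eq (by positivity) (by positivity)]
    field_simp
  have hsubst := lintegral_exp_norm_sq_mul (E := E) hc (H := 1) measurable_one
  simp only [Pi.one_apply, mul_one, lintegral_one, measure_univ] at hsubst
  have hpos := Real.rpow_nonneg (one_sub_sq_pos hρ).le (-(d : ℝ) / 2)
  simp_rw [hdensity, ENNReal.ofReal_mul hpos]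
  rw [lintegral_const_mul' _ _ ENNReal.ofReal_ne_top, hsubst, ← ENNReal.ofReal_mul hpos, hconst]

theorem integrable_mehlerKernel_self (hρ : ρ ∈ Ioo 0 1) :
    Integrable (fun x : E => mehlerKernel ρ x x) γ := by
  have hcont : Continuous fun x : E => mehlerKernel ρ x x := by
    unfold mehlerKernel
    fun_prop
  refine (lintegral_ofReal_ne_top_iff_integrable hcont.aestronglyMeasurable
    (ae_of_all _ fun x => (mehlerKernel_pos hρ x x).le)).1 ?_
  rw [lintegral_mehlerKernel_self hρ]
  exact ENNReal.ofReal_ne_top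

theorem integral_mehlerKernel_self (hρ : ρ ∈ Ioo 0 1) :
    ∫ x : E, mehlerKernel ρ x x ∂γ = ((1 - ρ) ^ d)⁻¹ := by
  have hsub : 0 < 1 - ρ := sub_pos.2 hρ.2
  rw [integral_eq_lintegral_of_nonneg_ae (ae_of_all _ fun x => (mehlerKernel_pos hρ x x).le)
    (integrable_mehlerKernel_self hρ).aestronglyMeasurable, lintegral_mehlerKernel_self hρ,
    ENNReal.toReal_ofReal (by positivity)]

end KernelTrace

section MehlerContraction

theorem sq_lintegral_le {Ω : Type*} [MeasurableSpace Ω] {μ : Measure Ω} [IsProbabilityMeasure μ]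
    {f : Ω → ℝ≥0∞} (hf : AEMeasurable f μ) : (∫⁻ x, f x ∂μ) ^ 2 ≤ ∫⁻ x, f x ^ 2 ∂μ := by
  have hmono := eLpNorm_le_eLpNorm_of_exponent_le (one_le_two (α := ℝ≥0∞))
    hf.aestronglyMeasurable
  have hsq := eLpNorm_nnreal_pow_eq_lintegral (f := f) (p := 2) (μ := μ) two_ne_zero
  calc (∫⁻ x, f x ∂μ) ^ 2 = eLpNorm f 1 μ ^ 2 := by simp [eLpNorm_one_eq_lintegral_enorm]
    _ ≤ eLpNorm f 2 μ ^ 2 := pow_le_pow_left' hmono 2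
    _ = ∫⁻ x, f x ^ 2 ∂μ := by simpa using hsq

variable {E : Type*} [NormedAddCommGroup E] [InnerProductSpace ℝ E] [MeasurableSpace E]
  [BorelSpace E] [FiniteDimensional ℝ E] {ρ : ℝ}

local notation "γ" => stdGaussian E

theorem lintegral_mehlerKernel (hρ : ρ ∈ Ioo 0 1) (x : E) :
    ∫⁻ y, ENNReal.ofReal (mehlerKernel ρ x y) ∂γ = 1 := by
  simpa using (lintegral_comp_mehler hρ x (measurable_const (a := (1 : ℝ≥0∞)))).symm

theorem lintegral_sq_mehlerKernel_le_lintegral_sq (hρ : ρ ∈ Ioo 0 1) {f : E → ℝ≥0∞}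
    (hf : Measurable f) :
    ∫⁻ x, (∫⁻ y, ENNReal.ofReal (mehlerKernel ρ x y) * f y ∂γ) ^ 2 ∂γ ≤ ∫⁻ y, f y ^ 2 ∂γ := by
  have hK := measurable_ofReal_mehlerKernel (E := E) ρ
  calc ∫⁻ x, (∫⁻ y, ENNReal.ofReal (mehlerKernel ρ x y) * f y ∂γ) ^ 2 ∂γ
      ≤ ∫⁻ x, ∫⁻ y, ENNReal.ofReal (mehlerKernel ρ x y) * f y ^ 2 ∂γ ∂γ := by
        refine lintegral_mono fun x => ?_
        simp only [← lintegral_comp_mehler hρ x hf, ← lintegral_comp_mehler hρ x (hf.pow_const 2)]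
        exact sq_lintegral_le (by fun_prop)
    _ = ∫⁻ y, ∫⁻ x, ENNReal.ofReal (mehlerKernel ρ x y) * f y ^ 2 ∂γ ∂γ :=
        lintegral_lintegral_swap (by fun_prop)
    _ = ∫⁻ y, f y ^ 2 ∂γ := lintegral_congr fun y => by
        simp_rw [mehlerKernel_comm ρ _ y]
        rw [lintegral_mul_const _ hK.of_uncurry_left, lintegral_mehlerKernel hρ, one_mul]

theorem integral_mehlerKernel_mul (hρ : ρ ∈ Ioo 0 1) (y z : E) :
    ∫ x, mehlerKernel ρ x y * mehlerKernel ρ x z ∂γ = mehlerKernel (ρ ^ 2) y z := by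
  have hcont : Continuous fun x => mehlerKernel ρ x y * mehlerKernel ρ x z := by
    unfold mehlerKernel
    fun_prop
  rw [integral_eq_lintegral_of_nonneg_ae
    (ae_of_all _ fun x => (mul_pos (mehlerKernel_pos hρ x y) (mehlerKernel_pos hρ x z)).le)
    hcont.aestronglyMeasurable]
  simp_rw [ENNReal.ofReal_mul (mehlerKernel_pos hρ _ y).le]
  rw [lintegral_mehlerKernel_mul hρ,
    ENNReal.toReal_ofReal (mehlerKernel_pos (sq_mem_Ioo hρ) y z).le]

theorem memLp_mehlerKernel (hρ : ρ ∈ Ioo 0 1) (p : ℝ≥0∞) (x : E) : MemLp (mehlerKernel ρ x) p γ :=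
  .of_bound (integrable_mehlerKernel hρ x).aestronglyMeasurable _ (ae_of_all _ fun y => by
    rw [Real.norm_of_nonneg (mehlerKernel_pos hρ x y).le]
    exact mehlerKernel_le hρ x y)

theorem ennreal_mul_le_sq_add_sq (a b : ℝ≥0∞) : a * b ≤ a ^ 2 + b ^ 2 := by
  rcases le_total a b with h | h
  · calc a * b ≤ b * b := by gcongr
      _ ≤ a ^ 2 + b ^ 2 := by rw [← sq]; exact le_add_self
  · calc a * b ≤ a * a := by gcongr
      _ ≤ a ^ 2 + b ^ 2 := by rw [← sq]; exact le_self_add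

theorem integrable_mul_mehlerKernel_mul (hρ : ρ ∈ Ioo 0 1) {f g : E → ℝ} (hf : Measurable f)
    (hg : Measurable g) (hf2 : MemLp f 2 γ) (hg2 : MemLp g 2 γ) :
    Integrable (Function.uncurry fun x y => f y * mehlerKernel ρ x y * g x) ((γ).prod γ) := by
  have hK : Measurable (Function.uncurry fun x y : E => mehlerKernel ρ x y) :=
    (continuous_mehlerKernel ρ).measurable
  have hmeas : Measurable (Function.uncurry fun x y => f y * mehlerKernel ρ x y * g x) := by
    fun_prop
  refine ⟨hmeas.aestronglyMeasurable, ?_⟩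
  rw [hasFiniteIntegral_iff_enorm, lintegral_prod _ hmeas.enorm.aemeasurable]
  calc ∫⁻ x, ∫⁻ y, ‖f y * mehlerKernel ρ x y * g x‖ₑ ∂γ ∂γ
      = ∫⁻ x, (∫⁻ y, ENNReal.ofReal (mehlerKernel ρ x y) * ‖f y‖ₑ ∂γ) * ‖g x‖ₑ ∂γ := by
        simp_rw [enorm_mul, lintegral_mul_const' _ _ enorm_ne_top, mul_comm ‖f _‖ₑ,
          Real.enorm_of_nonneg (mehlerKernel_pos hρ _ _).le]
    _ ≤ ∫⁻ x, ((∫⁻ y, ENNReal.ofReal (mehlerKernel ρ x y) * ‖f y‖ₑ ∂γ) ^ 2 + ‖g x‖ₑ ^ 2) ∂γ :=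
        lintegral_mono fun x => ennreal_mul_le_sq_add_sq _ _
    _ ≤ eLpNorm f 2 γ ^ 2 + eLpNorm g 2 γ ^ 2 := by
        rw [lintegral_add_right _ (hg.enorm.pow_const 2), eLpNorm_two_sq, eLpNorm_two_sq]
        exact add_le_add_left (lintegral_sq_mehlerKernel_le_lintegral_sq hρ hf.enorm) _
    _ < ⊤ := ENNReal.add_lt_top.2 ⟨ENNReal.pow_lt_top hf2.2, ENNReal.pow_lt_top hg2.2⟩

end MehlerContraction

section Operator

theorem countable_of_orthonormal {𝕜 H ι : Type*} [RCLike 𝕜] [NormedAddCommGroup H]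
    [InnerProductSpace 𝕜 H] [TopologicalSpace.SeparableSpace H] {v : ι → H}
    (hv : Orthonormal 𝕜 v) : Countable ι := by
  have hdisjoint : (univ : Set ι).PairwiseDisjoint fun i => Metric.ball (v i) (1 / 2) := by
    intro i _ j _ hij
    refine Metric.ball_disjoint_ball ?_
    have hdist : ‖v i - v j‖ ^ 2 = 2 := by
      rw [norm_sub_sq (𝕜 := 𝕜), hv.1 i, hv.1 j, hv.2 hij]
      norm_num
    rw [dist_eq_norm]
    nlinarith [norm_nonneg (v i - v j)]
  exact countable_univ_iff.1 (hdisjoint.countable_of_isOpen (fun _ _ => Metric.isOpen_ball)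
    fun i _ => ⟨v i, Metric.mem_ball_self (by norm_num)⟩)

variable {n : ℕ} {t : ℝ}

local notation "𝔼" => EuclideanSpace ℝ (Fin n)
local notation "γ" => stdGaussian (EuclideanSpace ℝ (Fin n))

theorem eLpNorm_two_ouSemigroup_le_eLpNorm (ht : 0 < t) {f : 𝔼 → ℝ} (hf : Measurable f) :
    eLpNorm (ouSemigroup t f) 2 γ ≤ eLpNorm f 2 γ := by
  rw [← ENNReal.pow_le_pow_left_iff two_ne_zero, eLpNorm_two_sq, eLpNorm_two_sq]
  exact (lintegral_mono fun x => pow_le_pow_left' (enorm_ouSemigroup_le ht hf x) 2).trans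
    (lintegral_sq_mehlerKernel_le_lintegral_sq (exp_neg_mem_Ioo ht) hf.enorm)

theorem integral_ouSemigroup_mul_comm (ht : 0 < t) {f g : 𝔼 → ℝ} (hf : Measurable f)
    (hg : Measurable g) (hf2 : MemLp f 2 γ) (hg2 : MemLp g 2 γ) :
    ∫ x, ouSemigroup t f x * g x ∂γ = ∫ x, f x * ouSemigroup t g x ∂γ := by
  simp_rw [ouSemigroup_eq_integral ht hf.aestronglyMeasurable,
    ouSemigroup_eq_integral ht hg.aestronglyMeasurable, ← integral_mul_const,
    ← integral_const_mul]
  rw [integral_integral_swap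
    (integrable_mul_mehlerKernel_mul (exp_neg_mem_Ioo ht) hf hg hf2 hg2)]
  refine integral_congr_ae (ae_of_all _ fun x => integral_congr_ae (ae_of_all _ fun y => ?_))
  simp only [mehlerKernel_comm _ y x]
  ring

theorem ouSemigroup_mehlerKernel (ht : 0 < t) (x y : 𝔼) :
    ouSemigroup t (mehlerKernel (Real.exp (-t)) x) y = mehlerKernel (Real.exp (-t) ^ 2) x y := by
  have hρ := exp_neg_mem_Ioo ht
  rw [ouSemigroup_eq_integral ht (integrable_mehlerKernel hρ x).aestronglyMeasurable,
    ← integral_mehlerKernel_mul hρ]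
  simp_rw [mehlerKernel_comm _ _ x, mehlerKernel_comm _ _ y]

/-- The kernel of `N_t` is itself in `L²(γ)`, so the semigroup law follows from the symmetry
of `N_t`. -/
theorem ouSemigroup_ouSemigroup (ht : 0 < t) {f : 𝔼 → ℝ} (hf : Measurable f)
    (hf2 : MemLp f 2 γ) (x : 𝔼) :
    ouSemigroup t (ouSemigroup t f) x = ouSemigroup (2 * t) f x := by
  have hK : Measurable (mehlerKernel (Real.exp (-t)) x) :=
    (continuous_mehlerKernel _).measurable.of_uncurry_left
  have hexp : Real.exp (-(2 * t)) = Real.exp (-t) ^ 2 := by rw [← exp_neg_two_mul, neg_mul]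
  rw [ouSemigroup_eq_integral ht (measurable_ouSemigroup t hf).aestronglyMeasurable,
    ouSemigroup_eq_integral (by positivity) hf.aestronglyMeasurable,
    integral_ouSemigroup_mul_comm ht hf hK hf2 (memLp_mehlerKernel (exp_neg_mem_Ioo ht) 2 x)]
  simp_rw [ouSemigroup_mehlerKernel ht, hexp]

theorem memLp_two_ouSemigroup (ht : 0 < t) (f : Lp ℝ 2 γ) : MemLp (ouSemigroup t f) 2 γ :=
  ⟨aestronglyMeasurable_ouSemigroup ht (Lp.aestronglyMeasurable f),
    (eLpNorm_two_ouSemigroup_le_eLpNorm ht (Lp.stronglyMeasurable f).measurable).trans_lt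
      (Lp.memLp f).2⟩

/-- The Ornstein-Uhlenbeck semigroup at time `t > 0` as a contraction of `L²(γ)`. -/
noncomputable def ouOperator (ht : 0 < t) : Lp ℝ 2 γ →L[ℝ] Lp ℝ 2 γ :=
  LinearMap.mkContinuous
    { toFun := fun f => (memLp_two_ouSemigroup ht f).toLp _
      map_add' := fun f g => by
        rw [← MemLp.toLp_add]
        refine MemLp.toLp_congr _ _ (ae_of_all _ fun x => ?_)
        rw [ouSemigroup_congr_ae ht (Lp.coeFn_add f g)]
        exact integral_add
          (integrable_comp_mehlerPoint ht ((Lp.memLp f).integrable one_le_two) x)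
          (integrable_comp_mehlerPoint ht ((Lp.memLp g).integrable one_le_two) x)
      map_smul' := fun c f => by
        rw [RingHom.id_apply, ← MemLp.toLp_const_smul]
        refine MemLp.toLp_congr _ _ (ae_of_all _ fun x => ?_)
        rw [ouSemigroup_congr_ae ht (Lp.coeFn_smul c f)]
        exact integral_const_mul c _ }
    1 fun f => by
      change ‖(memLp_two_ouSemigroup ht f).toLp _‖ ≤ 1 * ‖f‖
      rw [one_mul, Lp.norm_toLp, Lp.norm_def]
      exact ENNReal.toReal_mono (Lp.eLpNorm_ne_top f)
        (eLpNorm_two_ouSemigroup_le_eLpNorm ht (Lp.stronglyMeasurable f).measurable)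

theorem coeFn_ouOperator (ht : 0 < t) (f : Lp ℝ 2 γ) :
    ouOperator ht f =ᵐ[γ] ouSemigroup t f :=
  MemLp.coeFn_toLp (memLp_two_ouSemigroup ht f)

theorem inner_ouOperator_comm (ht : 0 < t) (f g : Lp ℝ 2 γ) :
    inner ℝ (ouOperator ht f) g = inner ℝ f (ouOperator ht g) := by
  rw [L2.inner_def, L2.inner_def]
  calc ∫ x, inner ℝ (ouOperator ht f x) (g x) ∂γ
      = ∫ x, ouSemigroup t f x * g x ∂γ := integral_congr_ae <| by
        filter_upwards [coeFn_ouOperator ht f] with x hx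
        rw [hx, Real.inner_apply]
    _ = ∫ x, f x * ouSemigroup t g x ∂γ :=
        integral_ouSemigroup_mul_comm ht (Lp.stronglyMeasurable f).measurable
          (Lp.stronglyMeasurable g).measurable (Lp.memLp f) (Lp.memLp g)
    _ = ∫ x, inner ℝ (f x) (ouOperator ht g x) ∂γ := integral_congr_ae <| by
        filter_upwards [coeFn_ouOperator ht g] with x hx
        rw [hx, Real.inner_apply]

theorem ouOperator_half_half (ht : 0 < t) (f : Lp ℝ 2 γ) :
    ouOperator (half_pos ht) (ouOperator (half_pos ht) f) = ouOperator ht f := by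
  refine Lp.ext ((coeFn_ouOperator _ _).trans
    (EventuallyEq.trans (ae_of_all _ fun x => ?_) (coeFn_ouOperator ht f).symm))
  rw [ouSemigroup_congr_ae (half_pos ht) (coeFn_ouOperator _ f), ouSemigroup_ouSemigroup
    (half_pos ht) (Lp.stronglyMeasurable f).measurable (Lp.memLp f), mul_div_cancel₀ t two_ne_zero]

theorem inner_ouOperator_self (ht : 0 < t) (f : Lp ℝ 2 γ) :
    inner ℝ f (ouOperator ht f) = ‖ouOperator (half_pos ht) f‖ ^ 2 := by
  rw [← ouOperator_half_half ht, ← inner_ouOperator_comm, real_inner_self_eq_norm_sq]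

theorem isPositive_ouOperator (ht : 0 < t) : (ouOperator (n := n) ht).IsPositive := by
  refine ⟨inner_ouOperator_comm ht, fun f => ?_⟩
  rw [ContinuousLinearMap.reApplyInnerSelf_apply, inner_ouOperator_comm, inner_ouOperator_self]
  exact sq_nonneg _

theorem tsum_enorm_ouSemigroup_sq {ι : Type*} (b : HilbertBasis ι ℝ (Lp ℝ 2 γ)) (ht : 0 < t)
    (x : 𝔼) : ∑' i, ‖ouSemigroup t (b i) x‖ₑ ^ 2 =
      ENNReal.ofReal (mehlerKernel (Real.exp (-t) ^ 2) x x) := by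
  have hρ := exp_neg_mem_Ioo ht
  have hmem := memLp_mehlerKernel hρ 2 x
  have hcoeff (i : ι) : inner ℝ (hmem.toLp _) (b i) = ouSemigroup t (b i) x := by
    rw [ouSemigroup_eq_integral ht (Lp.aestronglyMeasurable _), L2.inner_def]
    refine integral_congr_ae ?_
    filter_upwards [hmem.coeFn_toLp] with y hy
    rw [hy, Real.inner_apply, mul_comm]
  have hnorm : inner ℝ (hmem.toLp _) (hmem.toLp _) = mehlerKernel (Real.exp (-t) ^ 2) x x := by
    rw [← integral_mehlerKernel_mul hρ, L2.inner_def]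
    refine integral_congr_ae ?_
    filter_upwards [hmem.coeFn_toLp] with y hy
    rw [hy, Real.inner_apply, mehlerKernel_comm]
  have hparseval := b.hasSum_inner_mul_inner (hmem.toLp _) (hmem.toLp _)
  simp_rw [real_inner_comm (hmem.toLp _) (b _), hcoeff, hnorm, ← sq] at hparseval
  rw [← hparseval.tsum_eq, ENNReal.ofReal_tsum_of_nonneg (fun i => sq_nonneg _)
    hparseval.summable]
  refine tsum_congr fun i => ?_
  rw [← ofReal_norm, ← ENNReal.ofReal_pow (norm_nonneg _), Real.norm_eq_abs, sq_abs]

theorem tsum_enorm_ouOperator_sq {ι : Type*} (b : HilbertBasis ι ℝ (Lp ℝ 2 γ)) (ht : 0 < t) :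
    ∑' i, ‖ouOperator ht (b i)‖ₑ ^ 2 =
      ENNReal.ofReal ((1 - Real.exp (-(2 * t))) ^ n)⁻¹ := by
  have : Fact ((2 : ℝ≥0∞) ≠ ⊤) := ⟨ENNReal.ofNat_ne_top⟩
  have : Countable ι := countable_of_orthonormal b.orthonormal
  simp_rw [Lp.enorm_def, eLpNorm_congr_ae (coeFn_ouOperator ht (b _)), eLpNorm_two_sq]
  rw [← lintegral_tsum fun i => (memLp_two_ouSemigroup ht (b i)).1.enorm.pow_const 2]
  simp_rw [tsum_enorm_ouSemigroup_sq b ht]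
  rw [lintegral_mehlerKernel_self (sq_mem_Ioo (exp_neg_mem_Ioo ht)), finrank_euclideanSpace_fin,
    ← exp_neg_two_mul, neg_mul]

theorem hasSum_inner_ouOperator {ι : Type*} (b : HilbertBasis ι ℝ (Lp ℝ 2 γ)) (ht : 0 < t) :
    HasSum (fun i => inner ℝ (b i) (ouOperator ht (b i))) ((1 - Real.exp (-t)) ^ n)⁻¹ := by
  have htsum := tsum_enorm_ouOperator_sq b (half_pos ht)
  have hpos : 0 < 1 - Real.exp (-t) := sub_pos.2 (exp_neg_mem_Ioo ht).2
  rw [mul_div_cancel₀ t two_ne_zero] at htsum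
  have hsum := ENNReal.hasSum_toReal (htsum ▸ ENNReal.ofReal_ne_top)
  rw [← ENNReal.tsum_toReal_eq fun i => ENNReal.pow_ne_top enorm_ne_top, htsum,
    ENNReal.toReal_ofReal (by positivity)] at hsum
  simpa only [inner_ouOperator_self, ENNReal.toReal_pow, toReal_enorm] using hsum

end Operator

section NashYoung

theorem YoungBound.withDensity {X Y : Type*} [MeasurableSpace X] [MeasurableSpace Y]
    {μ : Measure X} {ν : Measure Y} [SFinite ν] {K : X → Y → ℝ≥0∞} {α β : ℝ} {C : ℝ≥0∞}
    {φ : X → ℝ≥0∞} {ψ : Y → ℝ≥0∞} (hα : α ∈ Icc 0 1) (hβ : β ∈ Icc 0 1) (hφ : Measurable φ)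
    (hψ : Measurable ψ) (hK : Measurable (Function.uncurry K))
    (h : YoungBound μ ν (fun x y => φ x ^ (1 - α) * ψ y ^ (1 - β) * K x y) α β C) :
    YoungBound (μ.withDensity φ) (ν.withDensity ψ) K α β C := by
  intro f g hf hg
  have hsplit {s : ℝ} (hs : s ∈ Icc (0 : ℝ) 1) (a b : ℝ≥0∞) :
      a * b ^ s = a ^ (1 - s) * (a * b) ^ s := by
    rw [ENNReal.mul_rpow_of_nonneg _ _ hs.1, ← mul_assoc,
      ← ENNReal.rpow_add_of_nonneg _ _ (sub_nonneg.2 hs.2) hs.1, sub_add_cancel, ENNReal.rpow_one]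
  have hKfg : Measurable (Function.uncurry fun x y => f x ^ α * g y ^ β * K x y) := by fun_prop
  refine le_of_eq_of_le ?_ ((h (hφ.mul hf) (hψ.mul hg)).trans_eq ?_)
  · rw [lintegral_withDensity_eq_lintegral_mul _ hφ hKfg.lintegral_prod_right]
    refine lintegral_congr fun x => ?_
    have hKx : Measurable (K x) := hK.comp measurable_prodMk_left
    rw [Pi.mul_apply, lintegral_withDensity_eq_lintegral_mul _ hψ (by fun_prop),
      ← lintegral_const_mul _ (by fun_prop)]
    refine lintegral_congr fun y => ?_
    simp only [Pi.mul_apply]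
    calc _ = φ x * f x ^ α * (ψ y * g y ^ β) * K x y := by ring
      _ = _ := by
        rw [hsplit hα, hsplit hβ]
        ring
  · rw [lintegral_withDensity_eq_lintegral_mul _ hφ hf,
      lintegral_withDensity_eq_lintegral_mul _ hψ hg]

/-- The constant `M` of the dimensional Nash inequality, in terms of `ρ = e^{-t}` and of the
dilation ratio `c = e^{-a/2}`. -/
noncomputable def mehlerNashConst (ρ c p q : ℝ) : ℝ :=
  ((p - 1) / ρ ^ 2) ^ (1 - 1 / p) * ((q - 1) / c ^ 2) ^ (1 / q - 1) *
    ((1 - ρ ^ 2) / (q - p)) ^ (1 / q - 1 / p)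

variable {ρ c p q : ℝ}

theorem gaussianYoungConst_mul {α β s τ : ℝ} (hα : 0 < α) (hβ : 0 < β) (hαβ : 1 < α + β)
    (hs : 0 < s) (hτ : 0 < τ) :
    (2 * Real.pi) ^ ((α + β) / 2 - 1) * gaussianYoungConst α β s τ =
      √(s ^ (α - 1) * τ ^ (β - 1) * ((α + β - 1) / (α * β))) := by
  have hθ : 0 < α + β - 1 := by linarith
  have hpi : 0 < 2 * Real.pi := by positivity
  rw [gaussianYoungConst, Real.sqrt_mul (by positivity), Real.sqrt_mul (by positivity)]
  have hsqrt {x : ℝ} (hx : 0 < x) (e : ℝ) : √(x ^ (e - 1)) = x ^ (e / 2) / √x := by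
    rw [Real.sqrt_eq_rpow, Real.sqrt_eq_rpow, ← Real.rpow_mul hx.le, ← Real.rpow_sub hx]
    ring_nf
  have hprod : √(α * s * (β * τ) / (α + β - 1)) = √s * √τ * √(α * β) / √(α + β - 1) := by
    rw [Real.sqrt_div (by positivity), ← Real.sqrt_mul hs.le, ← Real.sqrt_mul (by positivity)]
    ring_nf
  rw [hsqrt hs, hsqrt hτ, hprod, Real.div_rpow hs.le hpi.le, Real.div_rpow hτ.le hpi.le,
    Real.sqrt_div hθ.le, Real.rpow_sub hpi, Real.rpow_one, add_div, Real.rpow_add hpi]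
  field_simp

theorem inv_div_rpow_neg {x y : ℝ} (hx : 0 < x) (hy : 0 < y) (e : ℝ) :
    (x⁻¹ / y) ^ (-e) = x ^ e * y ^ e := by
  rw [Real.rpow_neg (by positivity), ← Real.inv_rpow (by positivity), inv_div, div_inv_eq_mul,
    mul_comm, Real.mul_rpow hx.le hy.le]

theorem sqrt_mehlerNashConst (hρ : ρ ∈ Ioo 0 1) (hc : 0 < c) (hp : 1 < p) (hpq : p < q) :
    c / √(1 - ρ ^ 2) * ((2 * Real.pi) ^ ((1 / p + (1 - 1 / q)) / 2 - 1) *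
      gaussianYoungConst (1 / p) (1 - 1 / q) ((q - p) / (1 - ρ ^ 2) / ((p - 1) / ρ ^ 2))
        ((q - p) / (1 - ρ ^ 2) / ((q - 1) / c ^ 2))) = √(mehlerNashConst ρ c p q) := by
  have hR := one_sub_sq_pos hρ
  have hp0 : 0 < p := by linarith
  have hq0 : 0 < q := by linarith
  have hN : 0 < q - p := sub_pos.2 hpq
  have hA : 0 < (p - 1) / ρ ^ 2 := div_pos (by linarith) (pow_pos hρ.1 2)
  have hB : 0 < (q - 1) / c ^ 2 := div_pos (by linarith) (by positivity)
  have hinv : 1 / q < 1 / p := one_div_lt_one_div_of_lt hp0 hpq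
  have hinv' : 1 / q < 1 := (div_lt_one hq0).2 (hp.trans hpq)
  have hc' : c / √(1 - ρ ^ 2) = √(c ^ 2 / (1 - ρ ^ 2)) := by
    rw [Real.sqrt_div (sq_nonneg c), Real.sqrt_sq hc.le]
  rw [gaussianYoungConst_mul (by positivity) (by linarith) (by linarith) (by positivity)
    (by positivity), hc', ← Real.sqrt_mul (by positivity), mehlerNashConst]
  congr 1
  have hτ : c ^ 2 / (1 - ρ ^ 2) * ((1 / p + (1 - 1 / q) - 1) / (1 / p * (1 - 1 / q))) =
      (q - p) / (1 - ρ ^ 2) / ((q - 1) / c ^ 2) := by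
    have : q - 1 ≠ 0 := by linarith
    field_simp
    ring
  have hN' : 0 < (1 - ρ ^ 2) / (q - p) := div_pos hR hN
  rw [mul_left_comm, hτ, ← inv_div (1 - ρ ^ 2) (q - p)]
  generalize (1 - ρ ^ 2) / (q - p) = N at hN' ⊢
  generalize (p - 1) / ρ ^ 2 = A at hA ⊢
  generalize (q - 1) / c ^ 2 = B at hB ⊢
  calc _ = (N⁻¹ / A) ^ (-(1 - 1 / p)) * (N⁻¹ / B) ^ (-(1 / q - 1)) := by
        rw [mul_assoc, ← Real.rpow_add_one (by positivity)]
        ring_nf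
    _ = A ^ (1 - 1 / p) * B ^ (1 / q - 1) * (N ^ (1 - 1 / p) * N ^ (1 / q - 1)) := by
        rw [inv_div_rpow_neg hN' hA, inv_div_rpow_neg hN' hB]
        ring
    _ = _ := by
        rw [← Real.rpow_add hN']
        ring_nf

variable {E : Type*} [NormedAddCommGroup E] [InnerProductSpace ℝ E]

local notation "d" => (Module.finrank ℝ E : ℝ)

theorem stdGaussianPDF_rpow (x : E) (s : ℝ) : stdGaussianPDF x ^ s =
    (2 * Real.pi) ^ (-d / 2 * s) * Real.exp (-‖x‖ ^ 2 / 2 * s) := by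
  rw [stdGaussianPDF, Real.mul_rpow (by positivity) (Real.exp_pos _).le,
    ← Real.rpow_mul (by positivity), ← Real.exp_mul]

theorem stdGaussianPDF_rpow_mul_mehlerKernel {α β u v : ℝ} (hρ : ρ ∈ Ioo 0 1) (hc : 0 < c)
    (hu : u ^ 2 = c ^ 2 / (1 - ρ ^ 2) - α) (hv : v ^ 2 = (1 - β) + ρ ^ 2 / (1 - ρ ^ 2))
    (huv : u * v = ρ * c / (1 - ρ ^ 2)) (z x : E) :
    stdGaussianPDF z ^ (1 - α) * stdGaussianPDF x ^ (1 - β) *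
        (mehlerKernel ρ x (c • z) * gaussianRatio 0 c⁻¹ z) =
      (c / √(1 - ρ ^ 2) * (2 * Real.pi) ^ ((α + β) / 2 - 1)) ^ Module.finrank ℝ E *
        Real.exp (-‖u • z - v • x‖ ^ 2 / 2) := by
  have hR := one_sub_sq_pos hρ
  have hpi : 0 < 2 * Real.pi := by positivity
  have hconst : (c / √(1 - ρ ^ 2) * (2 * Real.pi) ^ ((α + β) / 2 - 1)) ^ Module.finrank ℝ E =
      (2 * Real.pi) ^ (-d / 2 * (1 - α)) * (2 * Real.pi) ^ (-d / 2 * (1 - β)) *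
        ((1 - ρ ^ 2) ^ (-d / 2) * c⁻¹ ^ (-d)) := by
    rw [← Real.rpow_natCast, Real.mul_rpow (by positivity) (by positivity),
      Real.div_rpow hc.le (by positivity), ← sqrt_rpow_neg hR.le, Real.rpow_neg (by positivity),
      Real.inv_rpow hc.le, ← Real.rpow_neg hc.le, neg_neg, ← Real.rpow_mul hpi.le,
      ← Real.rpow_add hpi]
    ring_nf
  have hnorm : ‖u • z - v • x‖ ^ 2 = (c ^ 2 / (1 - ρ ^ 2) - α) * ‖z‖ ^ 2 +
      ((1 - β) + ρ ^ 2 / (1 - ρ ^ 2)) * ‖x‖ ^ 2 - 2 * (ρ * c / (1 - ρ ^ 2)) * inner ℝ x z := by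
    rw [norm_sub_sq_real, norm_smul, norm_smul, mul_pow, mul_pow, Real.norm_eq_abs,
      Real.norm_eq_abs, sq_abs, sq_abs, hu, hv, ← huv, real_inner_smul_left,
      real_inner_smul_right, real_inner_comm]
    ring
  rw [hconst, hnorm, stdGaussianPDF_rpow, stdGaussianPDF_rpow, mehlerKernel, gaussianRatio,
    mul_mul_mul_comm ((2 * Real.pi) ^ (-d / 2 * (1 - α))),
    mul_mul_mul_comm ((1 - ρ ^ 2) ^ (-d / 2)), mul_mul_mul_comm ((2 * Real.pi) ^ _ * _),
    ← Real.exp_add, ← Real.exp_add,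
    ← Real.exp_add, norm_smul, Real.norm_of_nonneg hc.le, real_inner_smul_right, sub_zero]
  congr 2
  field_simp
  ring

variable [MeasurableSpace E] [BorelSpace E] [FiniteDimensional ℝ E]

local notation "γ" => stdGaussian E

theorem measurable_ofReal_mehlerKernel_smul_mul (ρ c : ℝ) :
    Measurable (Function.uncurry fun z x : E =>
      ENNReal.ofReal (mehlerKernel ρ x (c • z) * gaussianRatio 0 c⁻¹ z)) := by
  refine Measurable.ennreal_ofReal (Continuous.measurable ?_)
  unfold mehlerKernel gaussianRatio
  fun_prop

theorem YoungBound.mehlerKernel_smul_of_sq_eq {α β s τ u v : ℝ} (hρ : ρ ∈ Ioo 0 1) (hc : 0 < c)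
    (hα : α ∈ Ioo 0 1) (hβ : β ∈ Ioo 0 1) (hαβ : 1 < α + β) (hs : 0 < s) (hτ : 0 < τ)
    (hsu : α * s * (1 - α) = (α + β - 1) * u ^ 2) (hτv : β * τ * (1 - β) = (α + β - 1) * v ^ 2)
    (hu : u ^ 2 = c ^ 2 / (1 - ρ ^ 2) - α) (hv : v ^ 2 = (1 - β) + ρ ^ 2 / (1 - ρ ^ 2))
    (huv : u * v = ρ * c / (1 - ρ ^ 2)) :
    YoungBound γ γ (fun z x => ENNReal.ofReal (mehlerKernel ρ x (c • z) * gaussianRatio 0 c⁻¹ z))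
      α β (ENNReal.ofReal (c / √(1 - ρ ^ 2) * ((2 * Real.pi) ^ ((α + β) / 2 - 1) *
        gaussianYoungConst α β s τ)) ^ Module.finrank ℝ E) := by
  have hR := one_sub_sq_pos hρ
  rw [stdGaussian_eq_withDensity]
  refine .withDensity ⟨hα.1.le, hα.2.le⟩ ⟨hβ.1.le, hβ.2.le⟩ measurable_ofReal_stdGaussianPDF
    measurable_ofReal_stdGaussianPDF (measurable_ofReal_mehlerKernel_smul_mul ρ c) ?_
  convert! (YoungBound.gaussian (E := E) hα hβ hαβ hs hτ hsu hτv).const_mul (by fun_prop)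
    (ENNReal.ofReal (c / √(1 - ρ ^ 2) * (2 * Real.pi) ^ ((α + β) / 2 - 1)) ^
      Module.finrank ℝ E) using 1
  · funext z x
    have hz := stdGaussianPDF_pos z
    have hx := stdGaussianPDF_pos x
    rw [ENNReal.ofReal_rpow_of_pos hz, ENNReal.ofReal_rpow_of_pos hx,
      ← ENNReal.ofReal_mul (by positivity), ← ENNReal.ofReal_mul (by positivity),
      stdGaussianPDF_rpow_mul_mehlerKernel hρ hc hu hv huv, ENNReal.ofReal_mul (by positivity),
      ENNReal.ofReal_pow (by positivity)]
  · rw [← mul_pow, ← ENNReal.ofReal_mul (by positivity), mul_assoc]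

theorem YoungBound.mehlerKernel_smul (hρ : ρ ∈ Ioo 0 1) (hc : 0 < c) (hp : 1 < p) (hpq : p < q)
    (hpc : p * c ^ 2 = 1 + ρ ^ 2 * (q - 1)) :
    YoungBound γ γ (fun z x => ENNReal.ofReal (mehlerKernel ρ x (c • z) * gaussianRatio 0 c⁻¹ z))
      (1 / p) (1 - 1 / q) (ENNReal.ofReal √(mehlerNashConst ρ c p q) ^ Module.finrank ℝ E) := by
  have hR := one_sub_sq_pos hρ
  have hρ0 := hρ.1
  have hp0 : 0 < p := by linarith
  have hq0 : 0 < q := by linarith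
  have hp1 : 0 < p - 1 := sub_pos.2 hp
  have hq1 : 0 < q - 1 := by linarith
  have : 0 < q - p := sub_pos.2 hpq
  have hα : 1 / p ∈ Ioo 0 1 := ⟨by positivity, (div_lt_one hp0).2 hp⟩
  have hα' : 1 / q ∈ Ioo 0 1 := ⟨by positivity, (div_lt_one hq0).2 (hp.trans hpq)⟩
  have hβ : 1 - 1 / q ∈ Ioo 0 1 := ⟨sub_pos.2 hα'.2, sub_lt_self _ hα'.1⟩
  have hαβ : 1 < 1 / p + (1 - 1 / q) := by linarith [one_div_lt_one_div_of_lt hp0 hpq]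
  have hu : √(ρ ^ 2 * q / (p * (1 - ρ ^ 2))) ^ 2 = ρ ^ 2 * q / (p * (1 - ρ ^ 2)) :=
    Real.sq_sqrt (by positivity)
  have hv : √(p * c ^ 2 / (q * (1 - ρ ^ 2))) ^ 2 = p * c ^ 2 / (q * (1 - ρ ^ 2)) :=
    Real.sq_sqrt (by positivity)
  rw [← sqrt_mehlerNashConst hρ hc hp hpq]
  refine .mehlerKernel_smul_of_sq_eq hρ hc hα hβ hαβ (by positivity) (by positivity)
    (u := √(ρ ^ 2 * q / (p * (1 - ρ ^ 2)))) (v := √(p * c ^ 2 / (q * (1 - ρ ^ 2))))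
    ?_ ?_ ?_ ?_ ?_
  · rw [hu]
    field_simp
    ring
  · rw [hv]
    field_simp
    ring
  · rw [hu]
    field_simp
    linarith
  · rw [hv]
    field_simp
    linarith
  · rw [← Real.sqrt_mul (by positivity), ← Real.sqrt_sq (by positivity : 0 ≤ ρ * c / (1 - ρ ^ 2))]
    congr 1
    field_simp

end NashYoung

section NashInequality

theorem lintegral_min_rpow_le {X : Type*} [MeasurableSpace X] {μ : Measure X} [IsFiniteMeasure μ]
    {q : ℝ} (hq : 1 < q) {H : X → ℝ≥0∞} (hH : Measurable H) {C : ℝ≥0∞}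
    (h : ∀ g : X → ℝ≥0∞, Measurable g →
      ∫⁻ x, g x ^ (1 - 1 / q) * H x ∂μ ≤ C * (∫⁻ x, g x ∂μ) ^ (1 - 1 / q)) (k : ℕ) :
    ∫⁻ x, min (H x) k ^ q ∂μ ≤ C ^ q := by
  have hq0 : 0 < q := by linarith
  set J := ∫⁻ x, min (H x) k ^ q ∂μ
  have hJtop : J ≠ ∞ := by
    refine ((lintegral_mono fun x => ENNReal.rpow_le_rpow (min_le_right _ _) hq0.le).trans_lt
      ?_).ne
    rw [lintegral_const]
    exact ENNReal.mul_lt_top (ENNReal.rpow_lt_top_of_nonneg hq0.le (ENNReal.natCast_ne_top k))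
      (measure_lt_top μ _)
  rcases eq_or_ne J 0 with hJ0 | hJ0
  · exact hJ0.trans_le zero_le
  have hJle : J ^ (1 / q) * J ^ (1 - 1 / q) ≤ C * J ^ (1 - 1 / q) := by
    refine le_trans ?_ (h (fun x => min (H x) k ^ q) (by fun_prop))
    rw [← ENNReal.rpow_add _ _ hJ0 hJtop, add_sub_cancel, ENNReal.rpow_one]
    refine lintegral_mono fun x => ?_
    have hsplit : q = q * (1 - 1 / q) + 1 := by
      field_simp
      ring
    have hexp : 0 ≤ q * (1 - 1 / q) := by linarith
    calc min (H x) k ^ q = min (H x) k ^ (q * (1 - 1 / q)) * min (H x) k := by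
          conv_lhs => rw [hsplit, ENNReal.rpow_add_of_nonneg _ _ hexp zero_le_one,
            ENNReal.rpow_one]
      _ ≤ (min (H x) k ^ q) ^ (1 - 1 / q) * H x := by
          rw [ENNReal.rpow_mul]
          exact mul_le_mul_right (min_le_left _ _) _
  have hpos : J ^ (1 - 1 / q) ≠ 0 := (ENNReal.rpow_pos (pos_iff_ne_zero.2 hJ0) hJtop).ne'
  have hfin : J ^ (1 - 1 / q) ≠ ∞ := ENNReal.rpow_ne_top_of_ne_zero hJ0 hJtop
  rw [ENNReal.mul_le_mul_iff_left hpos hfin] at hJle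
  simpa only [← ENNReal.rpow_mul, one_div_mul_cancel hq0.ne', ENNReal.rpow_one] using
    ENNReal.rpow_le_rpow hJle hq0.le

theorem lintegral_rpow_le_of_forall_lintegral_rpow_mul_le {X : Type*} [MeasurableSpace X]
    {μ : Measure X} [IsFiniteMeasure μ] {q : ℝ} (hq : 1 < q) {H : X → ℝ≥0∞} (hH : Measurable H)
    {C : ℝ≥0∞} (h : ∀ g : X → ℝ≥0∞, Measurable g →
      ∫⁻ x, g x ^ (1 - 1 / q) * H x ∂μ ≤ C * (∫⁻ x, g x ∂μ) ^ (1 - 1 / q)) :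
    ∫⁻ x, H x ^ q ∂μ ≤ C ^ q := by
  have hq0 : 0 ≤ q := by linarith
  refine le_of_tendsto' (lintegral_tendsto_of_tendsto_of_monotone (by fun_prop) (ae_of_all _
    fun x k l hkl => ?_) (ae_of_all _ fun x => ?_)) (lintegral_min_rpow_le hq hH h)
  · exact ENNReal.rpow_le_rpow (min_le_min_left _ (Nat.cast_le.2 hkl)) hq0
  · refine (ENNReal.continuous_rpow_const.tendsto _).comp ?_
    simpa only [min_top_right] using tendsto_const_nhds.min ENNReal.tendsto_nat_nhds_top

theorem YoungBound.lintegral_rpow_lintegral_le {X Y : Type*} [MeasurableSpace X]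
    [MeasurableSpace Y] {μ : Measure X} {ν : Measure Y} [SFinite μ] [IsFiniteMeasure ν]
    {K : X → Y → ℝ≥0∞} {p q : ℝ} {C : ℝ≥0∞} (h : YoungBound μ ν K (1 / p) (1 - 1 / q) C)
    (hp : 0 < p) (hq : 1 < q) (hK : Measurable (Function.uncurry K)) {F : X → ℝ≥0∞}
    (hF : Measurable F) :
    ∫⁻ y, (∫⁻ x, K x y * F x ∂μ) ^ q ∂ν ≤ (C * (∫⁻ x, F x ^ p ∂μ) ^ (1 / p)) ^ q := by
  have hKF : Measurable (Function.uncurry fun x y => K x y * F x) := by fun_prop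
  refine lintegral_rpow_le_of_forall_lintegral_rpow_mul_le hq hKF.lintegral_prod_left'
    fun g hg => ?_
  have hpinv (x : X) : (F x ^ p) ^ (1 / p) = F x := by
    rw [← ENNReal.rpow_mul, mul_one_div_cancel hp.ne', ENNReal.rpow_one]
  calc _ = ∫⁻ y, ∫⁻ x, (F x ^ p) ^ (1 / p) * g y ^ (1 - 1 / q) * K x y ∂μ ∂ν := by
        refine lintegral_congr fun y => ?_
        have : Measurable fun x => K x y := hK.comp measurable_prodMk_right
        rw [← lintegral_const_mul _ (by fun_prop)]
        refine lintegral_congr fun x => ?_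
        rw [hpinv, Function.uncurry_apply_pair]
        ring
    _ = ∫⁻ x, ∫⁻ y, (F x ^ p) ^ (1 / p) * g y ^ (1 - 1 / q) * K x y ∂ν ∂μ :=
        lintegral_lintegral_swap (by fun_prop)
    _ ≤ _ := h (by fun_prop) hg

variable {E : Type*} [NormedAddCommGroup E] [InnerProductSpace ℝ E] [MeasurableSpace E]
  [BorelSpace E] [FiniteDimensional ℝ E] {ρ c p q : ℝ}

local notation "γ" => stdGaussian E
local notation "d" => (Module.finrank ℝ E : ℝ)

theorem lintegral_stdGaussian_eq_comp_smul (hc : 0 < c) {H : E → ℝ≥0∞} (hH : Measurable H) :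
    ∫⁻ y, H y ∂γ = ∫⁻ z, ENNReal.ofReal (gaussianRatio 0 c⁻¹ z) * H (c • z) ∂γ := by
  simpa only [Function.comp_apply, zero_add, smul_inv_smul₀ hc.ne'] using
    lintegral_stdGaussian_comp_add_smul (0 : E) (inv_pos.2 hc) (hH.comp (measurable_const_smul c))

theorem lintegral_mehlerKernel_mul_eq_comp_smul (hc : 0 < c) (x : E) {F : E → ℝ≥0∞}
    (hF : Measurable F) : ∫⁻ y, ENNReal.ofReal (mehlerKernel ρ x y) * F y ∂γ =
      ∫⁻ z, ENNReal.ofReal (mehlerKernel ρ x (c • z) * gaussianRatio 0 c⁻¹ z) * F (c • z) ∂γ := by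
  have hK : Measurable fun y => ENNReal.ofReal (mehlerKernel ρ x y) :=
    (measurable_ofReal_mehlerKernel ρ).of_uncurry_left
  refine (lintegral_stdGaussian_eq_comp_smul hc (hK.mul hF)).trans (lintegral_congr fun z => ?_)
  rw [ENNReal.ofReal_mul' (gaussianRatio_pos 0 (inv_pos.2 hc) z).le, Pi.mul_apply]
  ring

theorem lintegral_rpow_lintegral_mehlerKernel_le (hρ : ρ ∈ Ioo 0 1) (hc : 0 < c) (hp : 1 < p)
    (hpq : p < q) (hpc : p * c ^ 2 = 1 + ρ ^ 2 * (q - 1)) {F : E → ℝ≥0∞} (hF : Measurable F) :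
    ∫⁻ x, (∫⁻ y, ENNReal.ofReal (mehlerKernel ρ x y) * F y ∂γ) ^ q ∂γ ≤
      (ENNReal.ofReal √(mehlerNashConst ρ c p q) ^ Module.finrank ℝ E *
        (∫⁻ z, F (c • z) ^ p ∂γ) ^ (1 / p)) ^ q := by
  simp_rw [lintegral_mehlerKernel_mul_eq_comp_smul hc _ hF]
  exact (YoungBound.mehlerKernel_smul hρ hc hp hpq hpc).lintegral_rpow_lintegral_le
    (zero_lt_one.trans hp) (hp.trans hpq) (measurable_ofReal_mehlerKernel_smul_mul ρ c)
    (hF.comp (measurable_const_smul c))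

theorem memLp_gaussianRatio {r : ℝ} (hr : 0 < r) (hc : 0 < c) (hrc : r * (1 - c ^ 2) < 1) :
    MemLp (gaussianRatio (0 : E) c⁻¹) (ENNReal.ofReal r) γ := by
  set k := √(1 - r * (1 - c ^ 2))
  have hk : 0 < k := Real.sqrt_pos.2 (by linarith)
  have hk2 : k ^ 2 = 1 - r * (1 - c ^ 2) := Real.sq_sqrt (by linarith)
  refine (integrable_norm_rpow_iff (continuous_gaussianRatio 0 c⁻¹).aestronglyMeasurable
    (ENNReal.ofReal_pos.2 hr).ne' ENNReal.ofReal_ne_top).1 ?_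
  refine ((integrable_gaussianRatio (0 : E) (inv_pos.2 hk)).const_mul
    ((c⁻¹ ^ (-d)) ^ r * k⁻¹ ^ d)).congr (ae_of_all _ fun y => ?_)
  dsimp only
  rw [ENNReal.toReal_ofReal hr.le, Real.norm_of_nonneg (gaussianRatio_pos 0 (inv_pos.2 hc) y).le,
    gaussianRatio, gaussianRatio, Real.mul_rpow (by positivity) (by positivity), ← Real.exp_mul]
  have hconst : k⁻¹ ^ d * k⁻¹ ^ (-d) = 1 := by
    rw [← Real.rpow_add (by positivity), add_neg_cancel, Real.rpow_zero]
  rw [mul_assoc, ← mul_assoc _ (k⁻¹ ^ (-d)), hconst, one_mul, sub_zero, inv_pow, inv_pow, hk2]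
  congr 2
  field_simp
  ring

theorem integrable_of_memLp_comp_smul (hc : 0 < c) (hp : 1 < p) (hpc : 1 < p * c ^ 2) {f : E → ℝ}
    (hfp : MemLp (fun z => f (c • z)) (ENNReal.ofReal p) γ) : Integrable f γ := by
  have hconj := Real.HolderConjugate.conjExponent hp
  have hratio : MemLp (gaussianRatio (0 : E) c⁻¹) (ENNReal.ofReal p.conjExponent) γ := by
    refine memLp_gaussianRatio hconj.symm.pos hc ?_
    rw [Real.conjExponent, div_mul_eq_mul_div, div_lt_one (by linarith)]
    linarith
  have : ENNReal.HolderConjugate (ENNReal.ofReal p) (ENNReal.ofReal p.conjExponent) :=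
    hconj.ennrealOfReal
  have hmul : Integrable (fun z => f (c • z) * gaussianRatio 0 c⁻¹ z) γ :=
    hfp.integrable_mul hratio
  have hsubst := integrable_stdGaussian_comp_add_smul (0 : E) (inv_pos.2 hc)
    (f := fun z => f (c • z)) hfp.1
  simpa only [zero_add, smul_inv_smul₀ hc.ne'] using hsubst.2 hmul

end NashInequality

section DimensionalNash

variable {n : ℕ} {t a p q : ℝ}

local notation "𝔼" => EuclideanSpace ℝ (Fin n)
local notation "γ" => stdGaussian 𝔼

theorem mehlerPoint_zero (x y : 𝔼) : mehlerPoint 0 x y = x := by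
  simp [mehlerPoint]

theorem ouSemigroup_zero (f : 𝔼 → ℝ) : ouSemigroup 0 f = f := by
  funext x
  simp [ouSemigroup, mehlerPoint_zero]

theorem dilation_dilation_neg (a : ℝ) (f : 𝔼 → ℝ) : dilation a (dilation (-a) f) = f := by
  funext x
  rw [dilation, dilation, smul_smul, ← Real.exp_add, neg_div, neg_add_cancel, Real.exp_zero,
    one_smul]

theorem eLpNorm_eq_zero_of_eLpNorm_dilation_eq_zero {f : 𝔼 → ℝ} (hf : AEStronglyMeasurable f γ)
    {r s : ℝ≥0∞} (hr : r ≠ 0) (h : eLpNorm (dilation a f) r γ = 0) : eLpNorm f s γ = 0 := by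
  have hmeas : AEStronglyMeasurable (dilation a f) γ :=
    hf.comp_quasiMeasurePreserving (quasiMeasurePreserving_smul (Real.exp_pos _))
  have hzero := dilation_congr_ae (-a) ((eLpNorm_eq_zero_iff hmeas hr).1 h)
  have hf0 := dilation_dilation_neg (-a) f
  rw [neg_neg] at hf0
  rw [hf0] at hzero
  exact (eLpNorm_congr_ae hzero).trans eLpNorm_zero

theorem nashConst_zero (hp : 1 < p) (hpq : p < q) : nashConst 0 a p q = ∞ := by
  have hX : 0 < (p - 1) / Real.exp (-2 * 0) := div_pos (by linarith) (Real.exp_pos _)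
  have hY : 0 < (q - 1) / Real.exp (-a) := div_pos (by linarith) (Real.exp_pos _)
  have hexp : 1 / q - 1 / p < 0 := sub_neg.2 (one_div_lt_one_div_of_lt (by linarith) hpq)
  have hZ : (1 - Real.exp (-2 * 0)) / (q - p) = 0 := by simp
  rw [nashConst, ENNReal.ofReal_rpow_of_pos hX, ENNReal.ofReal_rpow_of_pos hY,
    ← ENNReal.ofReal_mul (by positivity), hZ, ENNReal.ofReal_zero, ENNReal.zero_rpow_of_neg hexp]
  exact ENNReal.mul_top (ENNReal.ofReal_pos.2 (by positivity)).ne'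

theorem eLpNorm_le_nashConst_zero_mul (hp : 1 < p) (hpq : p < q) {f : 𝔼 → ℝ}
    (hf : AEStronglyMeasurable f γ) : eLpNorm f (ENNReal.ofReal q) γ ≤
      nashConst 0 a p q ^ ((n : ℝ) / 2) * eLpNorm (dilation (-a) f) (ENNReal.ofReal p) γ := by
  have hp0 : ENNReal.ofReal p ≠ 0 := (ENNReal.ofReal_pos.2 (by linarith)).ne'
  have hq0 : ENNReal.ofReal q ≠ 0 := (ENNReal.ofReal_pos.2 (by linarith)).ne'
  rw [nashConst_zero hp hpq]
  rcases Nat.eq_zero_or_pos n with rfl | hn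
  · have hconst (g : EuclideanSpace ℝ (Fin 0) → ℝ) : g = fun _ => g 0 :=
      funext fun x => congrArg g (Subsingleton.elim x 0)
    rw [hconst f, hconst (dilation (-a) fun _ => f 0), eLpNorm_const _ hq0 (NeZero.ne _),
      eLpNorm_const _ hp0 (NeZero.ne _)]
    simp [dilation]
  · rw [ENNReal.top_rpow_of_pos (by positivity)]
    rcases eq_or_ne (eLpNorm (dilation (-a) f) (ENNReal.ofReal p) γ) 0 with h | h
    · exact (eLpNorm_eq_zero_of_eLpNorm_dilation_eq_zero hf hp0 h).trans_le zero_le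
    · exact le_top.trans_eq (ENNReal.top_mul h).symm

theorem sq_exp_neg_half (a : ℝ) : Real.exp (-a / 2) ^ 2 = Real.exp (-a) := by
  rw [← Real.exp_nat_mul]
  ring_nf

theorem mul_sq_exp_neg_half_eq (h : q - 1 = Real.exp (2 * t) * (p * Real.exp (-a) - 1)) :
    p * Real.exp (-a / 2) ^ 2 = 1 + Real.exp (-t) ^ 2 * (q - 1) := by
  rw [sq_exp_neg_half, ← exp_neg_two_mul, h, ← mul_assoc, ← Real.exp_add, neg_mul, neg_add_cancel,
    Real.exp_zero]
  ring

theorem mehlerNashConst_pos (ht : 0 < t) (hp : 1 < p) (hpq : p < q) :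
    0 < mehlerNashConst (Real.exp (-t)) (Real.exp (-a / 2)) p q := by
  have hR := one_sub_sq_pos (exp_neg_mem_Ioo ht)
  have : 0 < p - 1 := by linarith
  have : 0 < q - 1 := by linarith
  have : 0 < q - p := by linarith
  unfold mehlerNashConst
  positivity

theorem nashConst_eq_ofReal (ht : 0 < t) (hp : 1 < p) (hpq : p < q) : nashConst t a p q =
    ENNReal.ofReal (mehlerNashConst (Real.exp (-t)) (Real.exp (-a / 2)) p q) := by
  have hR := one_sub_sq_pos (exp_neg_mem_Ioo ht)
  have hX : 0 < (p - 1) / Real.exp (-t) ^ 2 := div_pos (by linarith) (by positivity)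
  have hY : 0 < (q - 1) / Real.exp (-a) := div_pos (by linarith) (Real.exp_pos _)
  have hZ : 0 < (1 - Real.exp (-t) ^ 2) / (q - p) := div_pos hR (by linarith)
  rw [nashConst, mehlerNashConst, sq_exp_neg_half, exp_neg_two_mul, ENNReal.ofReal_rpow_of_pos hX,
    ENNReal.ofReal_rpow_of_pos hY, ENNReal.ofReal_rpow_of_pos hZ,
    ← ENNReal.ofReal_mul (by positivity), ← ENNReal.ofReal_mul (by positivity)]

theorem ofReal_sqrt_mehlerNashConst_pow (ht : 0 < t) (hp : 1 < p) (hpq : p < q) (n : ℕ) :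
    ENNReal.ofReal √(mehlerNashConst (Real.exp (-t)) (Real.exp (-a / 2)) p q) ^ n =
      nashConst t a p q ^ ((n : ℝ) / 2) := by
  rw [nashConst_eq_ofReal ht hp hpq, Real.sqrt_eq_rpow,
    ← ENNReal.ofReal_rpow_of_pos (mehlerNashConst_pos ht hp hpq), ← ENNReal.rpow_mul_natCast]
  ring_nf

theorem integrable_comp_mehlerPoint_of_memLp_dilation (ht : 0 < t) (hp : 1 < p) (hpq : p < q)
    (h : q - 1 = Real.exp (2 * t) * (p * Real.exp (-a) - 1)) {f : 𝔼 → ℝ}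
    (hfp : MemLp (dilation (-a) f) (ENNReal.ofReal p) γ) (x : 𝔼) :
    Integrable (fun y => f (mehlerPoint t x y)) γ := by
  refine integrable_comp_mehlerPoint ht
    (integrable_of_memLp_comp_smul (Real.exp_pos (-a / 2)) hp ?_ hfp) x
  rw [mul_sq_exp_neg_half_eq h, lt_add_iff_pos_right]
  exact mul_pos (by positivity) (by linarith)

theorem eLpNorm_ouSemigroup_le_nashConst_mul (ht : 0 < t) (hp : 1 < p) (hpq : p < q)
    (h : q - 1 = Real.exp (2 * t) * (p * Real.exp (-a) - 1)) {f : 𝔼 → ℝ}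
    (hf : AEStronglyMeasurable f γ) : eLpNorm (ouSemigroup t f) (ENNReal.ofReal q) γ ≤
      nashConst t a p q ^ ((n : ℝ) / 2) * eLpNorm (dilation (-a) f) (ENNReal.ofReal p) γ := by
  wlog hmeas : Measurable f generalizing f
  · have hmk := this hf.stronglyMeasurable_mk.aestronglyMeasurable
      hf.stronglyMeasurable_mk.measurable
    rwa [← ouSemigroup_congr_ae ht hf.ae_eq_mk,
      ← eLpNorm_congr_ae (dilation_congr_ae (-a) hf.ae_eq_mk)] at hmk
  have hp0 : 0 < p := by linarith
  have hq0 : 0 < q := by linarith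
  have hnash := lintegral_rpow_lintegral_mehlerKernel_le (exp_neg_mem_Ioo ht)
    (Real.exp_pos (-a / 2)) hp hpq (mul_sq_exp_neg_half_eq h) hmeas.enorm
  rw [finrank_euclideanSpace_fin, ofReal_sqrt_mehlerNashConst_pow ht hp hpq] at hnash
  rw [eLpNorm_eq_lintegral_rpow_enorm_toReal (ENNReal.ofReal_pos.2 hq0).ne' ENNReal.ofReal_ne_top,
    eLpNorm_eq_lintegral_rpow_enorm_toReal (ENNReal.ofReal_pos.2 hp0).ne' ENNReal.ofReal_ne_top,
    ENNReal.toReal_ofReal hq0.le, ENNReal.toReal_ofReal hp0.le, one_div q,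
    ENNReal.rpow_inv_le_iff hq0]
  exact (lintegral_mono fun x => ENNReal.rpow_le_rpow (enorm_ouSemigroup_le ht hmeas x)
    hq0.le).trans hnash

theorem dimensional_nash_inequality (ht : 0 ≤ t) (hp : 1 < p) (hpq : p < q)
    (h : q - 1 = Real.exp (2 * t) * (p * Real.exp (-a) - 1)) {f : 𝔼 → ℝ}
    (hf : AEStronglyMeasurable f γ) :
    (MemLp (dilation (-a) f) (ENNReal.ofReal p) γ →
      (∀ x, Integrable (fun y => f (mehlerPoint t x y)) γ) ∧
        AEStronglyMeasurable (ouSemigroup t f) γ) ∧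
      eLpNorm (ouSemigroup t f) (ENNReal.ofReal q) γ ≤
        nashConst t a p q ^ ((n : ℝ) / 2) * eLpNorm (dilation (-a) f) (ENNReal.ofReal p) γ := by
  rcases ht.eq_or_lt with rfl | ht
  · rw [ouSemigroup_zero]
    refine ⟨fun _ => ⟨fun x => ?_, hf⟩, eLpNorm_le_nashConst_zero_mul hp hpq hf⟩
    simp_rw [mehlerPoint_zero]
    exact integrable_const _
  · exact ⟨fun hfp => ⟨integrable_comp_mehlerPoint_of_memLp_dilation ht hp hpq h hfp,
      aestronglyMeasurable_ouSemigroup ht hf⟩, eLpNorm_ouSemigroup_le_nashConst_mul ht hp hpq h hf⟩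

end DimensionalNash

section NashConstLimit

variable {t : ℝ} {a : ℝ → ℝ}

theorem exp_neg_eq_div_of_constraint {q b : ℝ} (hq : 0 < q)
    (h : (2 : ℝ) - 1 = Real.exp (2 * t) * (q * Real.exp (-b) - 1)) :
    Real.exp (-b) = (Real.exp (-2 * t) + 1) / q := by
  have hinv : Real.exp (-2 * t) * Real.exp (2 * t) = 1 := by
    rw [← Real.exp_add, neg_mul, neg_add_cancel, Real.exp_zero]
  rw [eq_div_iff hq.ne']
  linear_combination (-Real.exp (-2 * t)) * h - (q * Real.exp (-b) - 1) * hinv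

theorem tendsto_dilation_parameter
    (ha : ∀ q ∈ Ioo (1 : ℝ) 2, (2 : ℝ) - 1 = Real.exp (2 * t) * (q * Real.exp (-(a q)) - 1)) :
    Tendsto (fun q => -(a q)) (𝓝[>] 1) (𝓝 (Real.log (Real.exp (-2 * t) + 1))) := by
  have hcont : ContinuousAt (fun q : ℝ => Real.log ((Real.exp (-2 * t) + 1) / q)) 1 :=
    ContinuousAt.log (by fun_prop (disch := norm_num)) (by positivity)
  have hlim := hcont.tendsto.mono_left (nhdsWithin_le_nhds (s := Ioi 1))
  rw [div_one] at hlim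
  refine hlim.congr' ?_
  filter_upwards [Ioo_mem_nhdsGT one_lt_two] with q hq
  rw [← exp_neg_eq_div_of_constraint (zero_lt_one.trans hq.1) (ha q hq), Real.log_exp]

theorem tendsto_sub_one_div_rpow {r : ℝ} (hr : 0 < r) :
    Tendsto (fun q : ℝ => ((q - 1) / r) ^ (1 - 1 / q)) (𝓝[>] 1) (𝓝 1) := by
  have hmullog : Continuous fun q : ℝ => (q - 1) / r * Real.log ((q - 1) / r) :=
    Real.continuous_mul_log.comp (by fun_prop)
  have hcont : ContinuousAt
      (fun q : ℝ => Real.exp (r / q * ((q - 1) / r * Real.log ((q - 1) / r)))) 1 :=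
    ((continuousAt_const.div continuousAt_id one_ne_zero).mul hmullog.continuousAt).rexp
  have hlim := hcont.tendsto.mono_left (nhdsWithin_le_nhds (s := Ioi 1))
  rw [sub_self, zero_div, zero_mul, mul_zero, Real.exp_zero] at hlim
  refine hlim.congr' ?_
  filter_upwards [self_mem_nhdsWithin] with q hq
  have hq1 : 0 < q - 1 := sub_pos.2 hq
  have hq0 : 0 < q := zero_lt_one.trans hq
  rw [Real.rpow_def_of_pos (by positivity)]
  congr 1
  field_simp

theorem tendsto_div_two_sub_rpow {r : ℝ} (hr : 0 < r) :
    Tendsto (fun q : ℝ => (r / (2 - q)) ^ (1 / 2 - 1 / q)) (𝓝[>] 1) (𝓝 (r ^ (1 / 2 : ℝ))⁻¹) := by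
  have hcont : ContinuousAt (fun q : ℝ => (r / (2 - q)) ^ (1 / 2 - 1 / q)) 1 := by
    refine ContinuousAt.rpow (ContinuousAt.div (by fun_prop) (by fun_prop) ?_) ?_ (.inl ?_)
    · norm_num
    · fun_prop (disch := norm_num)
    · norm_num [hr.ne']
  have hvalue : (r / (2 - 1)) ^ (1 / 2 - 1 / 1 : ℝ) = (r ^ (1 / 2 : ℝ))⁻¹ := by
    rw [← Real.rpow_neg hr.le]
    norm_num
  exact hvalue ▸ hcont.tendsto.mono_left nhdsWithin_le_nhds

theorem tendsto_dilation_factor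
    (ha : ∀ q ∈ Ioo (1 : ℝ) 2, (2 : ℝ) - 1 = Real.exp (2 * t) * (q * Real.exp (-(a q)) - 1)) :
    Tendsto (fun q => ((2 - 1) / Real.exp (-(a q))) ^ (1 / 2 - 1 : ℝ)) (𝓝[>] 1)
      (𝓝 ((Real.exp (-2 * t) + 1) ^ (1 / 2 : ℝ))) := by
  have hexp := (Real.continuous_exp.tendsto _).comp (tendsto_dilation_parameter ha)
  rw [Real.exp_log (by positivity)] at hexp
  refine (hexp.rpow_const (.inl (by positivity))).congr fun q => ?_
  rw [Function.comp_apply, show (2 - 1 : ℝ) = 1 by norm_num,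
    show (1 / 2 - 1 : ℝ) = -(1 / 2) by norm_num, one_div (Real.exp _),
    Real.inv_rpow (Real.exp_pos _).le, Real.rpow_neg (Real.exp_pos _).le, inv_inv]

theorem tendsto_nashConst (ht : 0 < t)
    (ha : ∀ q ∈ Ioo (1 : ℝ) 2, (2 : ℝ) - 1 = Real.exp (2 * t) * (q * Real.exp (-(a q)) - 1)) :
    Tendsto (fun q => nashConst t (a q) q 2) (𝓝[>] 1) (𝓝 (ENNReal.ofReal
      (((Real.exp (-2 * t) + 1) / (1 - Real.exp (-2 * t))) ^ (1 / 2 : ℝ)))) := by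
  have hR : 0 < 1 - Real.exp (-2 * t) := by
    rw [exp_neg_two_mul]
    exact one_sub_sq_pos (exp_neg_mem_Ioo ht)
  have hlim := ((tendsto_sub_one_div_rpow (Real.exp_pos (-2 * t))).mul
    (tendsto_dilation_factor ha)).mul (tendsto_div_two_sub_rpow hR)
  rw [one_mul, ← div_eq_mul_inv, ← Real.div_rpow (by positivity) hR.le] at hlim
  refine ((ENNReal.continuous_ofReal.tendsto _).comp hlim).congr' ?_
  filter_upwards [Ioo_mem_nhdsGT one_lt_two] with q hq
  rw [nashConst_eq_ofReal ht hq.1 hq.2, mehlerNashConst, sq_exp_neg_half, ← exp_neg_two_mul]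
  rfl

theorem tendsto_nashConst_rpow (ht : 0 < t) (n : ℕ)
    (ha : ∀ q ∈ Ioo (1 : ℝ) 2, (2 : ℝ) - 1 = Real.exp (2 * t) * (q * Real.exp (-(a q)) - 1)) :
    Tendsto (fun q => nashConst t (a q) q 2 ^ ((n : ℝ) / 2)) (𝓝[>] 1) (𝓝 (ENNReal.ofReal
      (((Real.exp (-2 * t) + 1) / (1 - Real.exp (-2 * t))) ^ ((n : ℝ) / 4)))) := by
  have hpos : 0 < (Real.exp (-2 * t) + 1) / (1 - Real.exp (-2 * t)) := by
    rw [exp_neg_two_mul]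
    exact div_pos (by positivity) (one_sub_sq_pos (exp_neg_mem_Ioo ht))
  have hlim := (ENNReal.continuous_rpow_const (y := (n : ℝ) / 2).tendsto _).comp
    (tendsto_nashConst ht ha)
  rw [ENNReal.ofReal_rpow_of_pos (Real.rpow_pos_of_pos hpos _), ← Real.rpow_mul hpos.le,
    show 1 / 2 * ((n : ℝ) / 2) = (n : ℝ) / 4 by ring] at hlim
  exact hlim

end NashConstLimit

section KernelDiagonal

variable {n : ℕ} {t : ℝ} {k : EuclideanSpace ℝ (Fin n) → EuclideanSpace ℝ (Fin n) → ℝ}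

local notation "𝔼" => EuclideanSpace ℝ (Fin n)
local notation "γ" => stdGaussian 𝔼

theorem IsOUKernel.eq_mehlerKernel (hk : IsOUKernel t k) (ht : 0 < t) :
    k = mehlerKernel (Real.exp (-t)) :=
  hk.unique (isOUKernel_mehlerKernel ht)

theorem IsOUKernel.eq_mehlerKernel_sq (hk : IsOUKernel (2 * t) k) (ht : 0 < t) :
    k = mehlerKernel (Real.exp (-t) ^ 2) := by
  rw [hk.eq_mehlerKernel (by positivity), ← exp_neg_two_mul, neg_mul]

theorem IsOUKernel.le_ouWeight_mul (hk : IsOUKernel (2 * t) k) (ht : 0 < t) (x y : 𝔼) :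
    k x y ≤ ouWeight t x * ouWeight t y := by
  rw [hk.eq_mehlerKernel_sq ht]
  exact mehlerKernel_sq_le_ouWeight_mul ht x y

theorem IsOUKernel.apply_self (hk : IsOUKernel (2 * t) k) (ht : 0 < t) (x : 𝔼) :
    k x x = ouWeight t x ^ 2 := by
  rw [hk.eq_mehlerKernel_sq ht, ouWeight_sq ht]

theorem IsOUKernel.integrable_apply_self (hk : IsOUKernel t k) (ht : 0 < t) :
    Integrable (fun x => k x x) γ := by
  rw [hk.eq_mehlerKernel ht]
  exact integrable_mehlerKernel_self (exp_neg_mem_Ioo ht)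

theorem IsOUKernel.integral_apply_self (hk : IsOUKernel t k) (ht : 0 < t) :
    ∫ x, k x x ∂γ = ((1 - Real.exp (-t)) ^ n)⁻¹ := by
  rw [hk.eq_mehlerKernel ht, integral_mehlerKernel_self (exp_neg_mem_Ioo ht),
    finrank_euclideanSpace_fin]

theorem IsOUKernel.integral_apply_self_eq_integral_ouWeight (hk : IsOUKernel t k) (ht : 0 < t) :
    ∫ x, k x x ∂γ = ∫ x, ouWeight (t / 2) x ^ 2 ∂γ := by
  have hk' : IsOUKernel (2 * (t / 2)) k := by rwa [mul_div_cancel₀ t two_ne_zero]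
  simp_rw [hk'.apply_self (half_pos ht)]

end KernelDiagonal

theorem mainTheorem8 (n : ℕ) :
    -- the dimensional hypercontractive bound
    (∀ t a q₁ q₂ : ℝ, 0 ≤ t → 1 < q₁ → q₁ < q₂ →
      q₂ - 1 = Real.exp (2 * t) * (q₁ * Real.exp (-a) - 1) →
      ∀ f : EuclideanSpace ℝ (Fin n) → ℝ,
        AEStronglyMeasurable f (stdGaussian (EuclideanSpace ℝ (Fin n))) →
        (MemLp (dilation (-a) f) (ENNReal.ofReal q₁) (stdGaussian (EuclideanSpace ℝ (Fin n))) →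
          (∀ x, Integrable (fun y => f (mehlerPoint t x y))
            (stdGaussian (EuclideanSpace ℝ (Fin n)))) ∧
          AEStronglyMeasurable (ouSemigroup t f) (stdGaussian (EuclideanSpace ℝ (Fin n)))) ∧
        eLpNorm (ouSemigroup t f) (ENNReal.ofReal q₂) (stdGaussian (EuclideanSpace ℝ (Fin n))) ≤
          nashConst t a q₁ q₂ ^ ((n : ℝ) / 2) *
            eLpNorm (dilation (-a) f) (ENNReal.ofReal q₁)
              (stdGaussian (EuclideanSpace ℝ (Fin n)))) ∧
    -- the parameters in the limit `q₁ → 1`, `q₂ = 2`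
    (∀ t : ℝ, 0 < t → ∀ a : ℝ → ℝ,
      (∀ q ∈ Ioo (1 : ℝ) 2, (2 : ℝ) - 1 = Real.exp (2 * t) * (q * Real.exp (-(a q)) - 1)) →
      Tendsto (fun q => -(a q)) (𝓝[>] 1) (𝓝 (Real.log (Real.exp (-2 * t) + 1))) ∧
      Tendsto (fun q => nashConst t (a q) q 2 ^ ((n : ℝ) / 2)) (𝓝[>] 1)
        (𝓝 (ENNReal.ofReal
          (((Real.exp (-2 * t) + 1) / (1 - Real.exp (-2 * t))) ^ ((n : ℝ) / 4))))) ∧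
    -- the limiting bound, and its weighted form
    (∀ t : ℝ, 0 < t → ∀ f : EuclideanSpace ℝ (Fin n) → ℝ,
      AEStronglyMeasurable f (stdGaussian (EuclideanSpace ℝ (Fin n))) →
      (Integrable (fun y => f y * ouWeight t y) (stdGaussian (EuclideanSpace ℝ (Fin n))) →
        (∀ x, Integrable (fun y => f (mehlerPoint t x y))
          (stdGaussian (EuclideanSpace ℝ (Fin n)))) ∧
        AEStronglyMeasurable (ouSemigroup t f) (stdGaussian (EuclideanSpace ℝ (Fin n)))) ∧
      eLpNorm (ouSemigroup t f) 2 (stdGaussian (EuclideanSpace ℝ (Fin n))) ≤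
        ENNReal.ofReal
          (((Real.exp (-2 * t) + 1) / (1 - Real.exp (-2 * t))) ^ ((n : ℝ) / 4)) *
          eLpNorm (dilation (Real.log (Real.exp (-2 * t) + 1)) f) 1
            (stdGaussian (EuclideanSpace ℝ (Fin n))) ∧
      ENNReal.ofReal
          (((Real.exp (-2 * t) + 1) / (1 - Real.exp (-2 * t))) ^ ((n : ℝ) / 4)) *
          eLpNorm (dilation (Real.log (Real.exp (-2 * t) + 1)) f) 1
            (stdGaussian (EuclideanSpace ℝ (Fin n))) =
        ∫⁻ y, ‖f y‖ₑ * ENNReal.ofReal (ouWeight t y)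
          ∂(stdGaussian (EuclideanSpace ℝ (Fin n))) ∧
      eLpNorm (ouSemigroup t f) 2 (stdGaussian (EuclideanSpace ℝ (Fin n))) ≤
        ∫⁻ y, ‖f y‖ₑ * ENNReal.ofReal (ouWeight t y)
          ∂(stdGaussian (EuclideanSpace ℝ (Fin n)))) ∧
    -- sharpness of the weighted bound: `V_t` is the least admissible weight
    (∀ t : ℝ, 0 < t → ∀ V : EuclideanSpace ℝ (Fin n) → ℝ≥0∞, Measurable V →
      (∀ f : EuclideanSpace ℝ (Fin n) → ℝ, Measurable f → (∃ C : ℝ, ∀ x, |f x| ≤ C) →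
        eLpNorm (ouSemigroup t f) 2 (stdGaussian (EuclideanSpace ℝ (Fin n))) ≤
          ∫⁻ y, ‖f y‖ₑ * V y ∂(stdGaussian (EuclideanSpace ℝ (Fin n)))) →
      ∀ᵐ y ∂(stdGaussian (EuclideanSpace ℝ (Fin n))), ENNReal.ofReal (ouWeight t y) ≤ V y) ∧
    -- the kernel exists and is unique
    (∀ t : ℝ, 0 < t →
      ∃! k : EuclideanSpace ℝ (Fin n) → EuclideanSpace ℝ (Fin n) → ℝ, IsOUKernel t k) ∧
    -- kernel bounds, with equality on the diagonal
    (∀ t : ℝ, 0 < t →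
      ∀ k : EuclideanSpace ℝ (Fin n) → EuclideanSpace ℝ (Fin n) → ℝ, IsOUKernel (2 * t) k →
        (∀ x y, k x y ≤ ouWeight t x * ouWeight t y) ∧
        (∀ x, k x x ≤ ouWeight t x ^ 2) ∧
        (∀ x, k x x = ouWeight t x ^ 2)) ∧
    -- the trace as the integral of the kernel over the diagonal
    (∀ t : ℝ, 0 < t →
      ∀ k : EuclideanSpace ℝ (Fin n) → EuclideanSpace ℝ (Fin n) → ℝ, IsOUKernel t k →
        Integrable (fun x => k x x) (stdGaussian (EuclideanSpace ℝ (Fin n))) ∧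
        ∫ x, k x x ∂(stdGaussian (EuclideanSpace ℝ (Fin n))) =
          ∫ x, ouWeight (t / 2) x ^ 2 ∂(stdGaussian (EuclideanSpace ℝ (Fin n))) ∧
        ∫ x, k x x ∂(stdGaussian (EuclideanSpace ℝ (Fin n))) =
          ((1 - Real.exp (-t)) ^ n)⁻¹) ∧
    -- it is the trace of the positive operator `N_t` on `L²(γ)`, in every Hilbert basis
    (∀ t : ℝ, 0 < t →
      ∃ A : Lp ℝ 2 (stdGaussian (EuclideanSpace ℝ (Fin n))) →L[ℝ]
          Lp ℝ 2 (stdGaussian (EuclideanSpace ℝ (Fin n))),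
        (∀ f : Lp ℝ 2 (stdGaussian (EuclideanSpace ℝ (Fin n))),
          (A f : EuclideanSpace ℝ (Fin n) → ℝ)
            =ᵐ[stdGaussian (EuclideanSpace ℝ (Fin n))] ouSemigroup t f) ∧
        A.IsPositive ∧
        ∀ (ι : Type*) (b : HilbertBasis ι ℝ (Lp ℝ 2 (stdGaussian (EuclideanSpace ℝ (Fin n))))),
          HasSum (fun i => inner ℝ (b i) (A (b i))) ((1 - Real.exp (-t)) ^ n)⁻¹) := by
  refine ⟨fun t a q₁ q₂ ht hq₁ hq h f hf => dimensional_nash_inequality ht hq₁ hq h hf,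
    fun t ht a ha => ⟨tendsto_dilation_parameter ha, tendsto_nashConst_rpow ht n ha⟩,
    fun t ht f hf => ?_, fun t ht V hV h => ouWeight_ae_le_of_eLpNorm_two_le ht hV h,
    fun t ht => ⟨_, isOUKernel_mehlerKernel ht, fun k hk => hk.unique (isOUKernel_mehlerKernel ht)⟩,
    fun t ht k hk => ?_, fun t ht k hk => ?_,
    fun t ht => ⟨ouOperator ht, coeFn_ouOperator ht, isPositive_ouOperator ht,
      fun ι b => hasSum_inner_ouOperator b ht⟩⟩
  · have hle := eLpNorm_two_ouSemigroup_le ht hf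
    have heq := eLpNorm_dilation_eq_lintegral_ouWeight ht hf
    exact ⟨fun hfV => ⟨integrable_comp_mehlerPoint ht
      (integrable_of_integrable_mul_ouWeight ht hf hfV), aestronglyMeasurable_ouSemigroup ht hf⟩,
      hle.trans_eq heq.symm, heq, hle⟩
  · have hdiag := hk.apply_self ht
    exact ⟨hk.le_ouWeight_mul ht, fun x => (hdiag x).le, hdiag⟩
  · exact ⟨hk.integrable_apply_self ht, hk.integral_apply_self_eq_integral_ouWeight ht,
      hk.integral_apply_self ht⟩
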